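/- **Setting.** Consider an episodic MDP with horizon $H\ge 1$, a measurable state space $\mathcal S$, a finite nonempty action set $\mathcal A$, a fixed initial state $s_1$, transition kernels $\mathbb P_h$ and deterministic measurable rewards $r_h\ge 0$ such that $\sum_{h=1}^H r_h(s_h,a_h)\le 1$ along every possible trajectory. Let $V^\pi_h$ be the value function of a deterministic Markov policy $\pi$, let $V^\star_h=\sup_\pi V_h^\pi$, and let $Q^\star_h=\sup_\pi Q^\pi_h$. A policy $\pi$ is $\eta$-optimal if $V_1^\pi(s_1)\ge V_1^\star(s_1)-\eta$. The Bellman operator is $(\mathcal T_h g)(s,a)=r_h(s,a)+\mathbb E_{s'\sim\mathbb P_h(\cdot\mid s,a)}\max_{a'}g(s',a')$. Let $\mathcal F=\mathcal F_1\times\dots\times\mathcal F_H$ and $\mathcal G=\mathcal G_1\times\dots\times\mathcal G_H$, where $\mathcal F_h,\mathcal G_h$ are classes of measurable functions $\mathcal S\times\mathcal A\to[0,1]$; put $f_{H+1}=0$. For $f\in\mathcal F$ let $\pi_f$ be its greedy policy, $\pi_{f,h}(s)=\pi_{f_h}(s)\in\arg\max_a f_h(s,a)$, with a fixed measurable tie-breaking.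 Let $\mathcal N_{\mathcal F\cup\mathcal G}(\rho)$ be the least cardinality of a $\rho$-cover of $\mathcal F\cup\mathcal G$ by its own elements in the metric $\max_h\|f_h-g_h\|_\infty$. Assume *realizability*, $Q^\star_h\in\mathcal F_h$ for all $h\in[H]$, and *generalized completeness*, $\mathcal T_h\mathcal F_{h+1}\subseteq\mathcal G_h$ for all $h\in[H]$ (with $\mathcal F_{H+1}=\{0\}$). **Dimension.** For a class $\Phi$ of functions on $\mathcal S$ and a family $\Pi$ of probability measures on $\mathcal S$, $\dim_{\rm DE}(\Phi,\Pi,\epsilon)$ is the length of the longest sequence $\rho_1,\dots,\rho_n\in\Pi$ for which there is $\epsilon'\ge\epsilon$ such that for every $i$ some $g\in\Phi$ satisfies $\big(\sum_{j<i}(\mathbb E_{\rho_j}g)^2\big)^{1/2}\le\epsilon'<|\mathbb E_{\rho_i}g|$. For $\Pi=(\Pi_h)_{h\in[H]}$ let $\dim_{\rm VBE}(\mathcal F,\Pi,\epsilon)=\max_{h\in[H]}\dim_{\rm DE}(\Phi_h,\Pi_h,\epsilon)$, where $\Phi_h=\{s\mapsto (f_h-\mathcal T_hf_{h+1})(s,\pi_{f_h}(s)):f\in\mathcal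 F\}$. Let $\mathcal D_{\mathcal F}$ consist of the laws of $s_h$ under the policies $\pi_f$, $f\in\mathcal F$, and let $\mathcal D_\Delta$ consist of all point masses on $\mathcal S$. **Algorithm (V-type GOLF with parameters $K\ge1$, $\beta$).** Let $\mathcal B^0=\mathcal F$. In epoch $k=1,\dots,K$: choose $f^k\in\arg\max_{f\in\mathcal B^{k-1}}f_1(s_1,\pi_f(s_1))$ (measurably in the data collected so far; it is required that the maximum is attained whenever $\mathcal B^{k-1}\neq\emptyset$, and $f^k\in\mathcal F$ is arbitrary if $\mathcal B^{k-1}=\emptyset$) and put $\pi^k=\pi_{f^k}$. For each $h\in[H]$, in a separate episode, follow $\pi^k$ at steps $1,\dots,h-1$, take a uniformly random action at step $h$, and add the tuple $(s_h,a_h,r_h,s_{h+1})$ to $\mathcal D_h$. Let $$\mathcal B^k=\Big\{f\in\mathcal F:\ \mathcal L_{\mathcal D_h}(f_h,f_{h+1})\le\inf_{g\in\mathcal G_h}\mathcal L_{\mathcal D_h}(g,f_{h+1})+\beta\ \text{ for all } h\in[H]\Big\},$$ $$\mathcal L_{\mathcal D_h}(\xi,\zeta)=\sum_{(s,a,r,s')\in\mathcal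 D_h}\big[\xi(s,a)-r-\max_{a'}\zeta(s',a')\big]^2 .$$ The output $\pi^{\rm out}$ is drawn uniformly at random from $\pi^1,\dots,\pi^K$. **Theorem.** For every $B\ge1$ there are constants $c,C_1,C_2>0$, depending on $B$ only, such that the following holds for every MDP and all classes as above and every $\epsilon>0$. Let $$d=\max\Big\{1,\min_{\Pi\in\{\mathcal D_\Delta,\mathcal D_{\mathcal F}\}}\dim_{\rm VBE}(\mathcal F,\Pi,\epsilon/H)\Big\},\qquad \rho=\frac{\epsilon^2}{H^2d|\mathcal A|},$$ $$T=\frac{H^2d|\mathcal A|}{\epsilon^2}\log\Big[\mathcal N_{\mathcal F\cup\mathcal G}(\rho)\cdot\frac{Hd|\mathcal A|}{\epsilon}\Big],$$ and assume that $d$ and $\mathcal N_{\mathcal F\cup\mathcal G}(\rho)$ are finite. Let $K\ge1$ be an integer with $K\ge C_1T$, and suppose that either * $\beta=c\,\log[KH\,\mathcal N_{\mathcal F\cup\mathcal G}(\rho)]$ and $K\le B\,C_1T$, or * $\beta=c\,\big(\log[KH\,\mathcal N_{\mathcal F\cup\mathcal G}(\rho)]+K\rho\big)$. Then the output $\pi^{\rm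 out}$ of V-type GOLF is $C_2\epsilon$-optimal with probability at least $0.99$. -/

import Mathlib

open MeasureTheory ProbabilityTheory

namespace VGolf

noncomputable section

universe u v

/-- Along every trajectory of `n` steps that is possible from state `s` at step `h`, whatever the
actions, the collected rewards sum to at most `b` (almost surely in the transitions). -/
def RewardSumLE {S : Type u} {A : Type v} [MeasurableSpace S] [MeasurableSpace A]
    (P : ℕ → Kernel (S × A) S) (r : ℕ → S → A → ℝ) : ℕ → ℕ → S → ℝ → Prop
  | 0, _, _, b => 0 ≤ b
  | n + 1, h, s, b =>
      ∀ a : A, ∀ᵐ s' ∂(P h (s, a)), RewardSumLE P r n (h + 1) s' (b - r h s a)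

/-- An episodic Markov decision process. Steps are numbered `0, …, H - 1`; the values of `P` and
`r` at indices `≥ H` play no role. -/
structure MDP (S : Type u) (A : Type v) [MeasurableSpace S] [MeasurableSpace A] where
  /-- length of an episode -/
  H : ℕ
  H_pos : 0 < H
  /-- transition probabilities -/
  P : ℕ → Kernel (S × A) S
  markov : ∀ h, IsMarkovKernel (P h)
  /-- deterministic rewards -/
  r : ℕ → S → A → ℝ
  r_measurable : ∀ h, Measurable (fun p : S × A => r h p.1 p.2)
  r_nonneg : ∀ h s a, 0 ≤ r h s a
  /-- the fixed initial state -/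
  s₁ : S
  r_sum_le : RewardSumLE P r H 0 s₁ 1

section Dimension

variable {X : Type u} [MeasurableSpace X]

/-- `ν` is `ε`-independent of `μ 0, …, μ (n - 1)` with respect to the function class `Φ`. -/
def IndepOf (Φ : Set (X → ℝ)) (ε : ℝ) (ν : Measure X) {n : ℕ} (μ : Fin n → Measure X) : Prop :=
  ∃ g ∈ Φ, Real.sqrt (∑ i, (∫ x, g x ∂(μ i)) ^ 2) ≤ ε ∧ ε < |∫ x, g x ∂ν|

/-- Distributional Eluder dimension: the length of the longest sequence in `Λ` such that, for some
`ε' ≥ ε`, every member is `ε'`-independent of its predecessors (`⊤` if there is no longest one). -/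
def dimDE (Φ : Set (X → ℝ)) (Λ : Set (Measure X)) (ε : ℝ) : ℕ∞ :=
  ⨆ (n : ℕ) (_ : ∃ μ : Fin n → Measure X, (∀ i, μ i ∈ Λ) ∧ ∃ ε' : ℝ, ε ≤ ε' ∧
    ∀ i : Fin n, IndepOf Φ ε' (μ i) (fun j : Fin i => μ (Fin.castLE i.isLt.le j))), (n : ℕ∞)

end Dimension

section CoveringNumber

variable {S : Type u} {A : Type v}

/-- Covering number of `V` at scale `ρ` (centres in `V`), for the distance
`max_h ‖f_h - g_h‖_∞`. -/
def coveringNumber (V : Set (ℕ → S → A → ℝ)) (ρ : ℝ) : ℕ∞ :=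
  ⨅ (V₀ : Set (ℕ → S → A → ℝ))
    (_ : V₀ ⊆ V ∧ ∀ f ∈ V, ∃ g ∈ V₀, ∀ h s a, |f h s a - g h s a| ≤ ρ), V₀.encard

end CoveringNumber

namespace MDP

variable {S : Type u} {A : Type v} [MeasurableSpace S] [MeasurableSpace A]

section Values

variable (M : MDP S A)

/-- Law of the state reached `n` steps later when `π` is followed from state `s` at step `h`. -/
def stateLaw (π : ℕ → S → A) (h : ℕ) (s : S) : ℕ → Measure S
  | 0 => Measure.dirac s
  | n + 1 => (stateLaw π h s n).bind (fun s' => M.P (h + n) (s', π (h + n) s'))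

/-- `V^π_h(s)`: expected sum of the rewards collected at steps `h, …, H - 1` by `π`,
starting from `s` at step `h`. -/
def V (π : ℕ → S → A) (h : ℕ) (s : S) : ℝ :=
  ∑ n ∈ Finset.range (M.H - h),
    ∫ s', M.r (h + n) s' (π (h + n) s') ∂(M.stateLaw π h s n)

/-- `Q^π_h(s, a)`. -/
def Q (π : ℕ → S → A) (h : ℕ) (s : S) (a : A) : ℝ :=
  M.r h s a + ∫ s', M.V π (h + 1) s' ∂(M.P h (s, a))

/-- Deterministic (measurable) policies. -/
def Policy : Type (max u v) := {π : ℕ → S → A // ∀ h < M.H, Measurable (π h)}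

/-- Optimal value function. -/
def Vstar (h : ℕ) (s : S) : ℝ := ⨆ π : M.Policy, M.V π.1 h s

/-- Optimal `Q`-value function. -/
def Qstar (h : ℕ) (s : S) (a : A) : ℝ := ⨆ π : M.Policy, M.Q π.1 h s a

/-- `π` is `ε`-optimal. -/
def IsOptimalUpTo (ε : ℝ) (π : ℕ → S → A) : Prop := M.Vstar 0 M.s₁ - ε ≤ M.V π 0 M.s₁

/-- Bellman operator `𝒯_h`. -/
def bellman (h : ℕ) (g : S → A → ℝ) (s : S) (a : A) : ℝ :=
  M.r h s a + ∫ s', (⨆ a', g s' a') ∂(M.P h (s, a))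

end Values

section Classes

variable (M : MDP S A)

/-- Every member of `F h` is a measurable function with values in `[0, 1]`. -/
def IsValueClass (F : ℕ → Set (S → A → ℝ)) : Prop :=
  ∀ h < M.H, ∀ g ∈ F h, Measurable (fun p : S × A => g p.1 p.2) ∧ ∀ s a, g s a ∈ Set.Icc 0 1

/-- The product class `F_0 × ⋯ × F_{H-1}`; each tuple is extended by `0` from step `H` on. -/
def tuples (F : ℕ → Set (S → A → ℝ)) : Set (ℕ → S → A → ℝ) :=
  {f | (∀ h < M.H, f h ∈ F h) ∧ ∀ h, M.H ≤ h → f h = 0}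

def Realizable (F : ℕ → Set (S → A → ℝ)) : Prop := ∀ h < M.H, M.Qstar h ∈ F h

def GeneralizedComplete (F G : ℕ → Set (S → A → ℝ)) : Prop :=
  ∀ f ∈ M.tuples F, ∀ h < M.H, M.bellman h (f (h + 1)) ∈ G h

/-- `σ h g` is a choice of the greedy action map `s ↦ argmax_a g(s, a)` for `g ∈ F h`
(ties broken in any measurable way). -/
def IsGreedy (F : ℕ → Set (S → A → ℝ)) (σ : ℕ → (S → A → ℝ) → S → A) : Prop :=
  ∀ h < M.H, ∀ g ∈ F h, Measurable (σ h g) ∧ ∀ s a, g s a ≤ g s (σ h g s)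

/-- The greedy policy `π_f`. -/
def greedyPolicy (σ : ℕ → (S → A → ℝ) → S → A) (f : ℕ → S → A → ℝ) : ℕ → S → A :=
  fun h => σ h (f h)

/-- State-wise Bellman residual class `(I - 𝒯_h) V_F`. -/
def residualClass (F : ℕ → Set (S → A → ℝ)) (σ : ℕ → (S → A → ℝ) → S → A) (h : ℕ) :
    Set (S → ℝ) :=
  {φ | ∃ f ∈ M.tuples F,
    φ = fun s => f h s (σ h (f h) s) - M.bellman h (f (h + 1)) s (σ h (f h) s)}

/-- V-type Bellman Eluder dimension with respect to the families `Λ h` of state distributions. -/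
def dimVBE (F : ℕ → Set (S → A → ℝ)) (σ : ℕ → (S → A → ℝ) → S → A)
    (Λ : ℕ → Set (Measure S)) (ε : ℝ) : ℕ∞ :=
  ⨆ h : Fin M.H, dimDE (M.residualClass F σ h) (Λ h) ε

/-- State distributions at step `h` generated by rolling in with greedy policies of the class. -/
def rollInLaws (F : ℕ → Set (S → A → ℝ)) (σ : ℕ → (S → A → ℝ) → S → A) (h : ℕ) :
    Set (Measure S) :=
  {μ | ∃ f ∈ M.tuples F, μ = M.stateLaw (greedyPolicy σ f) 0 M.s₁ h}

/-- Point masses. -/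
def diracLaws (S : Type u) [MeasurableSpace S] (_h : ℕ) : Set (Measure S) :=
  Set.range Measure.dirac

/-- `min_{Λ ∈ {𝒟_Δ, 𝒟_F}} dim_VBE(F, Λ, ε)`. -/
def minDimVBE (F : ℕ → Set (S → A → ℝ)) (σ : ℕ → (S → A → ℝ) → S → A) (ε : ℝ) : ℕ∞ :=
  min (M.dimVBE F σ (diracLaws S) ε) (M.dimVBE F σ (M.rollInLaws F σ) ε)

end Classes

section Algorithm

variable (M : MDP S A)

/-- Data of one epoch: for each step `h` a tuple `(s_h, a_h, r_h, s_{h+1})`. -/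
abbrev Epoch : Type (max u v) := Fin M.H → S × A × ℝ × S

/-- Law of the tuple collected by following `π` before step `h` and taking a uniformly random
action at step `h`. -/
def tupleLaw (π : ℕ → S → A) (h : ℕ) : Measure (S × A × ℝ × S) :=
  (M.stateLaw π 0 M.s₁ h).bind fun s =>
    (uniformOn (Set.univ : Set A)).bind fun a =>
      (M.P h (s, a)).map fun s' => (s, a, M.r h s a, s')

/-- Law of the data of one epoch run with `π`: one separate episode for every step. -/
def epochLaw (π : ℕ → S → A) : Measure M.Epoch :=
  Measure.pi fun h : Fin M.H => M.tupleLaw π h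

/-- Squared loss of `ξ` at step `h` on the data `D` of `k` epochs, with targets built from `ζ`. -/
def loss {k : ℕ} (D : Fin k → M.Epoch) (h : Fin M.H) (ξ ζ : S → A → ℝ) : ℝ :=
  ∑ i, (ξ (D i h).1 (D i h).2.1 - (D i h).2.2.1 - ⨆ a', ζ (D i h).2.2.2 a') ^ 2

/-- Confidence set after `k` epochs with data `D`; for `k = 0` all losses vanish and it is the
whole class (as `β ≥ 0`). -/
def confidenceSet (F G : ℕ → Set (S → A → ℝ)) (β : ℝ) {k : ℕ} (D : Fin k → M.Epoch) :
    Set (ℕ → S → A → ℝ) :=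
  {f | f ∈ M.tuples F ∧ ∀ h : Fin M.H,
    M.loss D h (f h) (f (h + 1)) ≤ (⨅ g : G h, M.loss D h g.1 (f (h + 1))) + β}

/-- `sel k D` is the function chosen in the epoch that follows `k < K` epochs with data `D`. It is a
member of the class that maximizes the optimistic initial value `f(s₁, π_f(s₁))` over the
confidence set; it is unconstrained within the class if the confidence set is empty. The choice
depends measurably on the data. -/
structure IsVGolf (F G : ℕ → Set (S → A → ℝ)) (σ : ℕ → (S → A → ℝ) → S → A) (K : ℕ)
    (β : ℝ) (sel : (k : ℕ) → (Fin k → M.Epoch) → ℕ → S → A → ℝ) : Prop where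
  mem : ∀ k < K, ∀ D, sel k D ∈ M.tuples F
  argmax : ∀ k < K, ∀ D, (M.confidenceSet F G β D).Nonempty →
    sel k D ∈ M.confidenceSet F G β D ∧
      ∀ f ∈ M.confidenceSet F G β D,
        f 0 M.s₁ (greedyPolicy σ f 0 M.s₁) ≤
          sel k D 0 M.s₁ (greedyPolicy σ (sel k D) 0 M.s₁)
  measurable_value : ∀ k < K, ∀ h < M.H,
    Measurable (fun p : (Fin k → M.Epoch) × S × A => sel k p.1 h p.2.1 p.2.2)
  measurable_policy : ∀ k < K, ∀ h < M.H,
    Measurable (fun p : (Fin k → M.Epoch) × S => greedyPolicy σ (sel k p.1) h p.2)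

/-- Law of the data of the first `k` epochs. -/
def dataLaw (σ : ℕ → (S → A → ℝ) → S → A)
    (sel : (k : ℕ) → (Fin k → M.Epoch) → ℕ → S → A → ℝ) :
    (k : ℕ) → Measure (Fin k → M.Epoch)
  | 0 => Measure.dirac Fin.elim0
  | k + 1 => (dataLaw σ sel k).bind fun D =>
      (M.epochLaw (greedyPolicy σ (sel k D))).map fun e =>
        (Fin.snoc D e : Fin (k + 1) → M.Epoch)

/-- The policy followed in epoch `k` of a run with data `D`. -/
def policyAt (σ : ℕ → (S → A → ℝ) → S → A)
    (sel : (k : ℕ) → (Fin k → M.Epoch) → ℕ → S → A → ℝ) {K : ℕ}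
    (D : Fin K → M.Epoch) (k : Fin K) : ℕ → S → A :=
  greedyPolicy σ (sel k fun i => D (Fin.castLE k.isLt.le i))

/-- Probability, over the data of `K` epochs and a uniformly random index `k`, that the output
policy `π^out = π^k` satisfies `p`. -/
def outputProb (σ : ℕ → (S → A → ℝ) → S → A)
    (sel : (k : ℕ) → (Fin k → M.Epoch) → ℕ → S → A → ℝ) (K : ℕ)
    (p : (ℕ → S → A) → Prop) : ENNReal :=
  ((M.dataLaw σ sel K).prod (uniformOn (Set.univ : Set (Fin K))))
    {x | p (M.policyAt σ sel x.1 x.2)}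

end Algorithm

end MDP

/-- The scale `ε² / (H² d |A|)`. -/
def scale (H d nA : ℕ) (ε : ℝ) : ℝ := ε ^ 2 / ((H : ℝ) ^ 2 * d * nA)

/-- `(H² d |A| / ε²) · log (N · H d |A| / ε)`. -/
def sampleSize (H d nA N : ℕ) (ε : ℝ) : ℝ :=
  ((H : ℝ) ^ 2 * d * nA / ε ^ 2) * Real.log (N * ((H : ℝ) * d * nA / ε))

end

end VGolf

/-! The argument combines optimism with a regression bound and an Eluder count.

Regression. For targets `r + max ζ(s')`, the excess squared loss of `ξ` over the backup `𝒯_h ζ` at a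
tuple is `e² + 2eη`, where `e` is the Bellman residual at the observed pair and `η` is noise that is
centred given that pair. Hence `excess / 8` has an exponential moment below `1` by a margin
proportional to `e²`, and `exp (∑ (mean squared residual / 32 - excess / 8))` is a supermartingale
along the run (`lintegral_exp_tupleLaw_le`, `IsSampling.measure_sum_gt_le`). Markov's inequality and
a union bound over epochs, steps and a finite cover show that, off an event of small probability, no
deviation exceeds a multiple of `log (K H N)`.

Consequences. On this event `Q⋆` stays in every confidence set (`qs_mem_confidenceSet`), so the
chosen functions are optimistic. The function chosen in an epoch also has small accumulated squared
residuals on the earlier epochs (`sum_sq_residual_le`). The uniform action costs a factor `|A|`,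
because the greedy action is one of `|A|` equally likely ones.

Eluder count. If all accumulated squares are at most `Γ`, then at most `(Γ / t² + 1) d` epochs have
a residual above `t` (`card_large_le`). Summing over levels, the residuals of `K` epochs add up to
`O(ε K + d + √(d Γ K))` per step (`sum_abs_le_of_dimDE`). By telescoping, the suboptimality of an
optimistic greedy policy is at most the sum over the steps of its expected residuals, so a uniformly
random epoch is good.

Both families of laws are treated together by a Boolean `b`. For `b = false` residuals are tested
against the roll-in laws. For `b = true` they are tested at the visited states, which are random;
the Eluder bound then holds for every data sequence, and conditional expectation given the past
returns the roll-in laws (`sum_lintegral_meanError_le`). -/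

namespace VGolf

open scoped ENNReal

set_option linter.unusedSectionVars false

/-! ### Measures and integrals depending measurably on a parameter -/

section Parametric

variable {Ω X Y : Type*} [MeasurableSpace Ω] [MeasurableSpace X] [MeasurableSpace Y]

theorem measurable_bind_param {κ : Ω → Measure X} (hκ : Measurable κ)
    (hp : ∀ ω, IsProbabilityMeasure (κ ω)) {η : Ω → X → Measure Y}
    (hη : Measurable (Function.uncurry η)) : Measurable fun ω => (κ ω).bind (η ω) := by
  have : IsMarkovKernel (⟨κ, hκ⟩ : Kernel Ω X) := ⟨hp⟩
  refine Measure.measurable_of_measurable_coe _ fun s hs => ?_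
  have h1 : ∀ ω, (κ ω).bind (η ω) s = ∫⁻ x, η ω x s ∂((⟨κ, hκ⟩ : Kernel Ω X) ω) := fun ω =>
    Measure.bind_apply hs (hη.comp measurable_prodMk_left).aemeasurable
  simp_rw [h1]
  exact Measurable.lintegral_kernel_prod_right ((Measure.measurable_coe hs).comp hη)

theorem measurable_lintegral_param {κ : Ω → Measure X} (hκ : Measurable κ)
    (hp : ∀ ω, IsProbabilityMeasure (κ ω)) {g : Ω → X → ℝ≥0∞}
    (hg : Measurable (Function.uncurry g)) : Measurable fun ω => ∫⁻ x, g ω x ∂κ ω := by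
  have : IsMarkovKernel (⟨κ, hκ⟩ : Kernel Ω X) := ⟨hp⟩
  exact Measurable.lintegral_kernel_prod_right (κ := ⟨κ, hκ⟩) hg

theorem measurable_integral_param {κ : Ω → Measure X} (hκ : Measurable κ)
    (hp : ∀ ω, IsProbabilityMeasure (κ ω)) {g : Ω → X → ℝ}
    (hg : Measurable (Function.uncurry g)) : Measurable fun ω => ∫ x, g ω x ∂κ ω := by
  have : IsMarkovKernel (⟨κ, hκ⟩ : Kernel Ω X) := ⟨hp⟩
  exact (StronglyMeasurable.integral_kernel_prod_right' (κ := ⟨κ, hκ⟩)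
    hg.stronglyMeasurable).measurable

theorem measurable_map_param {κ : Ω → Measure X} (hκ : Measurable κ)
    (hp : ∀ ω, IsProbabilityMeasure (κ ω)) {g : Ω → X → Y}
    (hg : Measurable (Function.uncurry g)) : Measurable fun ω => (κ ω).map (g ω) := by
  have h : ∀ ω, (κ ω).map (g ω) = (κ ω).bind fun x => Measure.dirac (g ω x) := fun ω =>
    (Measure.bind_dirac_eq_map _ (hg.comp measurable_prodMk_left)).symm
  simp_rw [h]
  exact measurable_bind_param hκ hp (Measure.measurable_dirac.comp hg)

theorem measurable_pi_param {ι : Type*} [Fintype ι] {κ : Ω → ι → Measure X}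
    (hκ : ∀ i, Measurable fun ω => κ ω i) (hp : ∀ ω i, IsProbabilityMeasure (κ ω i)) :
    Measurable fun ω => Measure.pi (κ ω) := by
  refine Measurable.measure_of_isPiSystem_of_isProbabilityMeasure generateFrom_pi.symm
    isPiSystem_pi ?_
  rintro _ ⟨s, hs, rfl⟩
  simp_rw [Measure.pi_pi]
  exact Finset.measurable_prod _ fun i _ =>
    (Measure.measurable_coe (hs i (Set.mem_univ i))).comp (hκ i)

theorem isProbabilityMeasure_bind' {κ : Measure X} [IsProbabilityMeasure κ] {η : X → Measure Y}
    (hη : Measurable η) (hp : ∀ x, IsProbabilityMeasure (η x)) :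
    IsProbabilityMeasure (κ.bind η) :=
  isProbabilityMeasure_bind hη.aemeasurable (.of_forall hp)

end Parametric

section Uniform

variable {X : Type*} [MeasurableSpace X] [MeasurableSingletonClass X] [Fintype X]

theorem lintegral_uniformOn_univ (f : X → ℝ≥0∞) :
    ∫⁻ x, f x ∂(uniformOn (Set.univ : Set X)) = (Fintype.card X : ℝ≥0∞)⁻¹ * ∑ x, f x := by
  rw [lintegral_fintype, Finset.mul_sum]
  refine Finset.sum_congr rfl fun x _ => ?_
  rw [uniformOn_univ, Measure.count_singleton, mul_comm, one_div]

end Uniform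

/-! ### Adaptively drawn observations and exponential supermartingales -/

section InitialSegment

variable {E : Type*}

/-- The first `k` of `K` observations. -/
def pre {K : ℕ} (D : Fin K → E) (k : ℕ) (hk : k ≤ K) : Fin k → E := fun i => D (Fin.castLE hk i)

theorem pre_snoc {K k : ℕ} (hk : k ≤ K) (D : Fin K → E) (e : E) :
    pre (Fin.snoc D e : Fin (K + 1) → E) k (hk.trans K.le_succ) = pre D k hk := by
  funext i
  have : Fin.castLE (hk.trans K.le_succ) i = (Fin.castLE hk i).castSucc := rfl
  rw [pre, this, Fin.snoc_castSucc, pre]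

theorem pre_self {K : ℕ} (D : Fin K → E) : pre D K le_rfl = D := rfl

end InitialSegment

noncomputable section Adaptive

variable {E : Type*} [MeasurableSpace E]

/-- Law of `k` successive observations, each drawn from a law chosen on the basis of the previous
ones. -/
def adaptiveLaw (κ : (k : ℕ) → (Fin k → E) → Measure E) : (k : ℕ) → Measure (Fin k → E)
  | 0 => Measure.dirac Fin.elim0
  | k + 1 => (adaptiveLaw κ k).bind fun D => (κ k D).map fun e => (Fin.snoc D e : Fin (k + 1) → E)

theorem measurable_pre {K k : ℕ} (hk : k ≤ K) : Measurable fun D : Fin K → E => pre D k hk :=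
  measurable_pi_lambda _ fun _ => measurable_pi_apply _

theorem measurable_snoc (k : ℕ) :
    Measurable fun p : (Fin k → E) × E => (Fin.snoc p.1 p.2 : Fin (k + 1) → E) := by
  refine measurable_pi_lambda _ fun i => ?_
  refine Fin.lastCases ?_ (fun j => ?_) i
  · simpa using measurable_snd
  · simp only [Fin.snoc_castSucc]
    exact (measurable_pi_apply j).comp measurable_fst

theorem measurable_snoc_right {k : ℕ} (D : Fin k → E) :
    Measurable fun e => (Fin.snoc D e : Fin (k + 1) → E) :=
  (measurable_snoc k).comp measurable_prodMk_left

/-- The sampling laws are probability measures depending measurably on the data. -/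
structure IsSampling (κ : (k : ℕ) → (Fin k → E) → Measure E) (K : ℕ) : Prop where
  meas : ∀ k < K, Measurable (κ k)
  prob : ∀ k < K, ∀ D, IsProbabilityMeasure (κ k D)

variable {κ : (k : ℕ) → (Fin k → E) → Measure E} {K : ℕ}

theorem IsSampling.measurable_step (h : IsSampling κ K) {k : ℕ} (hk : k < K) :
    Measurable fun D => (κ k D).map fun e => (Fin.snoc D e : Fin (k + 1) → E) :=
  measurable_map_param (g := fun D e => (Fin.snoc D e : Fin (k + 1) → E)) (h.meas k hk)
    (h.prob k hk) (measurable_snoc k)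

theorem IsSampling.isProbabilityMeasure (h : IsSampling κ K) :
    ∀ k ≤ K, IsProbabilityMeasure (adaptiveLaw κ k)
  | 0, _ => by rw [adaptiveLaw]; infer_instance
  | k + 1, hk => by
    have := h.isProbabilityMeasure k (by omega)
    have h2 := h.prob k (by omega)
    exact isProbabilityMeasure_bind' (h.measurable_step hk) fun D =>
      Measure.isProbabilityMeasure_map (measurable_snoc_right D).aemeasurable

theorem IsSampling.lintegral_succ (h : IsSampling κ K) {k : ℕ} (hk : k < K)
    {F : (Fin (k + 1) → E) → ℝ≥0∞} (hF : Measurable F) :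
    ∫⁻ D, F D ∂adaptiveLaw κ (k + 1) =
      ∫⁻ D, ∫⁻ e, F (Fin.snoc D e) ∂κ k D ∂adaptiveLaw κ k := by
  rw [adaptiveLaw, Measure.lintegral_bind (h.measurable_step hk).aemeasurable hF.aemeasurable]
  refine lintegral_congr fun D => ?_
  rw [lintegral_map hF (measurable_snoc_right D)]

theorem IsSampling.lintegral_pre (h : IsSampling κ K) {k : ℕ} {g : (Fin k → E) → ℝ≥0∞}
    (hg : Measurable g) : ∀ n (hk : k ≤ n), n ≤ K →
    ∫⁻ D, g (pre D k hk) ∂adaptiveLaw κ n = ∫⁻ D, g D ∂adaptiveLaw κ k := by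
  intro n hk
  induction n, hk using Nat.le_induction with
  | base => intro _; rfl
  | succ n hkn ih =>
    intro hn
    refine (h.lintegral_succ hn (hg.comp (measurable_pre _))).trans ?_
    rw [← ih (by omega)]
    refine lintegral_congr fun D => ?_
    have := h.prob n hn D
    simp [pre_snoc hkn]

/-- Tower property: observation `k` may be averaged over its conditional law given the first `k`
observations, and later observations integrate out. -/
theorem IsSampling.lintegral_next (h : IsSampling κ K) {k : ℕ} (hk : k < K)
    {g : (Fin k → E) → E → ℝ≥0∞} (hg : Measurable (Function.uncurry g)) :
    ∫⁻ D, g (pre D k hk.le) (D ⟨k, hk⟩) ∂adaptiveLaw κ K =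
      ∫⁻ D, ∫⁻ e, g (pre D k hk.le) e ∂κ k (pre D k hk.le) ∂adaptiveLaw κ K := by
  have h1 : Measurable fun D : Fin (k + 1) → E =>
      g (pre D k k.le_succ) (D (Fin.last k)) :=
    hg.comp ((measurable_pre _).prodMk (measurable_pi_apply _))
  rw [h.lintegral_pre (k := k) (g := fun D => ∫⁻ e, g D e ∂κ k D)
    (measurable_lintegral_param (h.meas k hk) (h.prob k hk) hg) K hk.le le_rfl]
  have h2 := h.lintegral_pre h1 K hk le_rfl
  have h3 := h.lintegral_succ hk h1
  refine Eq.trans ?_ (h2.trans (h3.trans ?_))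
  · rfl
  · refine lintegral_congr fun D => lintegral_congr fun e => ?_
    rw [pre_snoc le_rfl, Fin.snoc_last, pre_self]

/-- Integrating out the last observation first removes one factor, at most `1` in conditional mean,
and leaves the same product for a shorter sequence. -/
theorem IsSampling.lintegral_prod_le (h : IsSampling κ K) {w : (k : ℕ) → (Fin k → E) → E → ℝ≥0∞}
    (hw : ∀ k < K, Measurable (Function.uncurry (w k)))
    (hw1 : ∀ k < K, ∀ D, ∫⁻ e, w k D e ∂κ k D ≤ 1) : ∀ n ≤ K,
    ∫⁻ D, ∏ i : Fin n, w i (pre D i i.2.le) (D i) ∂adaptiveLaw κ n ≤ 1 := by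
  intro n
  induction n with
  | zero => intro _; simp [adaptiveLaw]
  | succ n ih =>
    intro hn
    have hm : ∀ m ≤ K, Measurable fun D : Fin m → E => ∏ i : Fin m, w i (pre D i i.2.le) (D i) :=
      fun m hm => Finset.measurable_prod _ fun i _ =>
        (hw i (i.2.trans_le hm)).comp ((measurable_pre _).prodMk (measurable_pi_apply _))
    rw [h.lintegral_succ hn (hm _ hn)]
    refine le_trans (lintegral_mono fun D => ?_) (ih (by omega))
    have h1 : ∀ e, ∏ i : Fin (n + 1), w i (pre (Fin.snoc D e : Fin (n + 1) → E) i i.2.le)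
        ((Fin.snoc D e : Fin (n + 1) → E) i) =
        (∏ i : Fin n, w i (pre D i i.2.le) (D i)) * w n D e := by
      intro e
      rw [Fin.prod_univ_castSucc]
      congr 1
      · refine Finset.prod_congr rfl fun i _ => ?_
        rw [Fin.snoc_castSucc]
        exact congrArg (fun q => w i q (D i)) (pre_snoc i.2.le D e)
      · rw [Fin.snoc_last]
        exact congrArg (fun q => w n q e) (pre_snoc le_rfl D e)
    simp_rw [h1]
    have h2 : Measurable (w n D) := (hw n hn).comp measurable_prodMk_left
    rw [lintegral_const_mul _ h2]
    exact mul_le_of_le_one_right' (hw1 n hn D)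

theorem IsSampling.measure_pre (h : IsSampling κ K) {k : ℕ} (hk : k ≤ K) {s : Set (Fin k → E)}
    (hs : MeasurableSet s) :
    adaptiveLaw κ K {D | pre D k hk ∈ s} = adaptiveLaw κ k s := by
  have := h.lintegral_pre (g := s.indicator 1) (measurable_one.indicator hs) K hk le_rfl
  rw [lintegral_indicator_one hs] at this
  rw [← this]
  exact (lintegral_indicator_one (measurable_pre hk hs)).symm

theorem IsSampling.ae_forall (h : IsSampling κ K) {s : Set E} (hs : MeasurableSet s)
    (hκ : ∀ k < K, ∀ D, ∀ᵐ e ∂κ k D, e ∈ s) :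
    ∀ᵐ D ∂adaptiveLaw κ K, ∀ i, D i ∈ s := by
  rw [ae_all_iff]
  intro i
  have hz := h.lintegral_next i.2 (g := fun _ e => sᶜ.indicator 1 e)
    ((measurable_one.indicator hs.compl).comp measurable_snd)
  have h0 : ∀ D, ∫⁻ e, sᶜ.indicator 1 e ∂κ i D = 0 := fun D => by
    rw [lintegral_indicator_one hs.compl]
    exact hκ i i.2 D
  simp only [h0, lintegral_zero] at hz
  have hm : Measurable fun D : Fin K → E => sᶜ.indicator (1 : E → ℝ≥0∞) (D i) :=
    (measurable_one.indicator hs.compl).comp (measurable_pi_apply i)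
  filter_upwards [(lintegral_eq_zero_iff hm).1 hz] with D hD
  by_contra hc
  simp [Set.indicator, hc] at hD

/-- Markov's inequality for an exponential supermartingale. -/
theorem IsSampling.measure_sum_gt_le (h : IsSampling κ K) {w : (k : ℕ) → (Fin k → E) → E → ℝ}
    (hw : ∀ k < K, Measurable (Function.uncurry (w k)))
    (hw1 : ∀ k < K, ∀ D, ∫⁻ e, ENNReal.ofReal (Real.exp (w k D e)) ∂κ k D ≤ 1) (θ : ℝ)
    {k : ℕ} (hk : k ≤ K) :
    adaptiveLaw κ K {D | θ ≤ ∑ i : Fin k, w i (pre (pre D k hk) i i.2.le) (pre D k hk i)} ≤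
      ENNReal.ofReal (Real.exp (-θ)) := by
  have hm : Measurable fun D : Fin k → E => ∑ i : Fin k, w i (pre D i i.2.le) (D i) :=
    Finset.measurable_sum _ fun i _ =>
      (hw i (i.2.trans_le hk)).comp ((measurable_pre _).prodMk (measurable_pi_apply _))
  have h1 := h.measure_pre hk (measurableSet_le (measurable_const (a := θ)) hm)
  refine h1.le.trans ?_
  have h2 := h.lintegral_prod_le (w := fun k D e => ENNReal.ofReal (Real.exp (w k D e)))
    (fun k hk => ENNReal.measurable_ofReal.comp (Real.measurable_exp.comp (hw k hk))) hw1 k hk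
  simp_rw [← ENNReal.ofReal_prod_of_nonneg (fun i _ => (Real.exp_pos _).le), ← Real.exp_sum] at h2
  have h3 := mul_meas_ge_le_lintegral (μ := adaptiveLaw κ k)
    (ENNReal.measurable_ofReal.comp (Real.measurable_exp.comp hm)) (ENNReal.ofReal (Real.exp θ))
  have h4 : {D : Fin k → E | θ ≤ ∑ i : Fin k, w i (pre D i i.2.le) (D i)} ⊆
      {D | ENNReal.ofReal (Real.exp θ) ≤ (ENNReal.ofReal ∘ Real.exp ∘ fun D : Fin k → E =>
        ∑ i : Fin k, w i (pre D i i.2.le) (D i)) D} := fun D hD =>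
    ENNReal.ofReal_le_ofReal (Real.exp_le_exp.2 hD)
  refine (measure_mono h4).trans ?_
  rw [Real.exp_neg, ENNReal.ofReal_inv_of_pos (Real.exp_pos _), ← one_mul (_ : ℝ≥0∞)⁻¹,
    ← div_eq_mul_inv, ENNReal.le_div_iff_mul_le (by simp [Real.exp_pos]) (by simp), mul_comm]
  exact h3.trans h2

end Adaptive

/-! ### Distributional Eluder dimension: from small residuals on the past to a small total -/

section Eluder

/-- Greedy colouring: if every `k ∈ I` has total weight less than `m * t` below it, then `m` colours
suffice to make the weight of each colour class below each of its members at most `t`. -/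
theorem exists_coloring {K m : ℕ} (I : Finset (Fin K)) (a : Fin K → Fin K → ℝ)
    (ha : ∀ i k, 0 ≤ a i k) {t : ℝ} (hm : 0 < m)
    (h : ∀ k ∈ I, ∑ i ∈ Finset.Iio k, a i k < m * t) :
    ∃ c : Fin K → Fin m, ∀ k ∈ I, ∑ i ∈ I with i < k ∧ c i = c k, a i k ≤ t := by
  have key : ∀ n : ℕ, ∃ c : Fin K → Fin m,
      ∀ k ∈ I, k.1 < n → ∑ i ∈ I with i < k ∧ c i = c k, a i k ≤ t := by
    intro n
    induction n with
    | zero => exact ⟨fun _ => ⟨0, hm⟩, fun k _ hk => absurd hk (by omega)⟩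
    | succ n ih =>
      obtain ⟨c, hc⟩ := ih
      by_cases hn : ∃ k ∈ I, k.1 = n
      · obtain ⟨k, hkI, hkn⟩ := hn
        have hex : ∃ j : Fin m, ∑ i ∈ I with i < k ∧ c i = j, a i k ≤ t := by
          by_contra! hcon
          have h1 : ∑ j : Fin m, ∑ i ∈ I with i < k ∧ c i = j, a i k ≤
              ∑ i ∈ Finset.Iio k, a i k := by
            have h2 : ∀ j : Fin m, ({i ∈ I | i < k ∧ c i = j} : Finset (Fin K)) =
                {i ∈ {i ∈ I | i < k} | c i = j} := fun j => by
              rw [Finset.filter_filter]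
            simp_rw [h2]
            rw [Finset.sum_fiberwise]
            refine Finset.sum_le_sum_of_subset_of_nonneg (fun i hi => ?_) fun i _ _ => ha i k
            simpa using (Finset.mem_filter.1 hi).2
          have h3 : ∑ _j : Fin m, t < ∑ j : Fin m, ∑ i ∈ I with i < k ∧ c i = j, a i k :=
            Finset.sum_lt_sum_of_nonempty ⟨⟨0, hm⟩, Finset.mem_univ _⟩ fun j _ => hcon j
          simp only [Finset.sum_const, Finset.card_univ, Fintype.card_fin, nsmul_eq_mul] at h3
          linarith [h k hkI]
        obtain ⟨j, hj⟩ := hex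
        -- Recolouring `k` alone is harmless for smaller indices, since their sums only involve
        -- indices below them.
        refine ⟨Function.update c k j, fun l hl hln => ?_⟩
        rcases eq_or_ne l k with rfl | hlk
        · refine le_of_eq_of_le (Finset.sum_congr (Finset.filter_congr fun i _ => ?_)
            fun _ _ => rfl) hj
          refine and_congr_right fun hi => ?_
          rw [Function.update_of_ne hi.ne, Function.update_self]
        · have hlt : l.1 < n := by
            have : l.1 ≠ k.1 := fun h => hlk (Fin.ext h)
            omega
          refine le_of_eq_of_le (Finset.sum_congr (Finset.filter_congr fun i _ => ?_)
            fun _ _ => rfl) (hc l hl hlt)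
          refine and_congr_right fun hi => ?_
          have hik : i ≠ k := fun h => by subst h; have := Fin.lt_def.1 hi; omega
          rw [Function.update_of_ne hik, Function.update_of_ne hlk]
      · refine ⟨c, fun k hk hkn => hc k hk ?_⟩
        have : k.1 ≠ n := fun h => hn ⟨k, hk, h⟩
        omega
  obtain ⟨c, hc⟩ := key K
  exact ⟨c, fun k hk => hc k hk k.2⟩

variable {X : Type*} [MeasurableSpace X] {Φ : Set (X → ℝ)} {Λ : Set (Measure X)}

/-- Enumerated increasingly, `J` becomes a sequence counted by `dimDE`, with `ε' = t`. -/
theorem card_le_of_indep {ε t : ℝ} {d K : ℕ} (hd : dimDE Φ Λ ε ≤ d) (ht : ε ≤ t) (ht0 : 0 ≤ t)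
    {μ : Fin K → Measure X} {φ : Fin K → X → ℝ} (J : Finset (Fin K)) (hμ : ∀ k ∈ J, μ k ∈ Λ)
    (hφ : ∀ k ∈ J, φ k ∈ Φ)
    (h1 : ∀ k ∈ J, ∑ i ∈ J with i < k, (∫ x, φ k x ∂μ i) ^ 2 ≤ t ^ 2)
    (h2 : ∀ k ∈ J, t < |∫ x, φ k x ∂μ k|) : J.card ≤ d := by
  have hle : (J.card : ℕ∞) ≤ dimDE Φ Λ ε := by
    let e := J.orderEmbOfFin rfl
    have he : ∀ i, e i ∈ J := fun i => J.orderEmbOfFin_mem rfl i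
    refine le_iSup₂_of_le (f := fun (n : ℕ) (_ : ∃ μ : Fin n → Measure X, (∀ i, μ i ∈ Λ) ∧
      ∃ ε' : ℝ, ε ≤ ε' ∧ ∀ i : Fin n, IndepOf Φ ε' (μ i)
        (fun j : Fin i => μ (Fin.castLE i.isLt.le j))) => (n : ℕ∞)) J.card
      ⟨fun i => μ (e i), fun i => hμ _ (he i), t, ht, fun i => ⟨φ (e i), hφ _ (he i), ?_,
        h2 _ (he i)⟩⟩ le_rfl
    refine Real.sqrt_le_iff.2 ⟨ht0, le_trans ?_ (h1 _ (he i))⟩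
    have hinj : Function.Injective fun j : Fin i => e (Fin.castLE i.isLt.le j) :=
      e.injective.comp (Fin.castLE_injective _)
    rw [← Finset.sum_image (f := fun k => (∫ x, φ (e i) x ∂μ k) ^ 2)
      (s := Finset.univ) (g := fun j : Fin i => e (Fin.castLE i.isLt.le j)) hinj.injOn]
    refine Finset.sum_le_sum_of_subset_of_nonneg ?_ fun _ _ _ => sq_nonneg _
    intro k hk
    obtain ⟨j, -, rfl⟩ := Finset.mem_image.1 hk
    exact Finset.mem_filter.2 ⟨he _, e.strictMono (Fin.lt_def.2 j.2)⟩
  exact_mod_cast hle.trans hd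

/-- With `m = ⌊Γ / t²⌋ + 1` colours the weight `Γ` is below `m t²`, so `exists_coloring` applies.
Inside one colour class every member has weight at most `t²` on its predecessors and more than `t`
on itself, so the class is an independent sequence and has at most `d` members. -/
theorem card_large_le {ε t Γ : ℝ} {d K : ℕ} (hd : dimDE Φ Λ ε ≤ d) (ht : ε ≤ t) (ht0 : 0 < t)
    (hΓ : 0 ≤ Γ) {μ : Fin K → Measure X} {φ : Fin K → X → ℝ} (I : Finset (Fin K))
    (hμ : ∀ k, μ k ∈ Λ) (hφ : ∀ k, φ k ∈ Φ)
    (h1 : ∀ k ∈ I, ∑ i ∈ Finset.Iio k, (∫ x, φ k x ∂μ i) ^ 2 ≤ Γ)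
    (h2 : ∀ k ∈ I, t < |∫ x, φ k x ∂μ k|) : (I.card : ℝ) ≤ (Γ / t ^ 2 + 1) * d := by
  set m := ⌊Γ / t ^ 2⌋₊ + 1
  have ht2 : 0 < t ^ 2 := by positivity
  have hm : Γ < m * t ^ 2 := by
    have := Nat.lt_floor_add_one (Γ / t ^ 2)
    rw [div_lt_iff₀ ht2] at this
    simpa [m] using this
  obtain ⟨c, hc⟩ := exists_coloring I (fun i k => (∫ x, φ k x ∂μ i) ^ 2)
    (fun _ _ => sq_nonneg _) (Nat.succ_pos _ : 0 < m) (t := t ^ 2)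
    fun k hk => (h1 k hk).trans_lt hm
  have hj : ∀ j ∈ Finset.univ, (Finset.card {k ∈ I | c k = j}) ≤ d := fun j _ => by
    refine card_le_of_indep hd ht ht0.le _ (fun k _ => hμ k) (fun k _ => hφ k) (fun k hk => ?_)
      fun k hk => h2 k (Finset.mem_filter.1 hk).1
    obtain ⟨hkI, hkc⟩ := Finset.mem_filter.1 hk
    refine le_of_eq_of_le ?_ (hc k hkI)
    rw [Finset.filter_filter, hkc]
    exact Finset.sum_congr (Finset.filter_congr fun i _ => and_comm) fun _ _ => rfl
  have h3 : I.card ≤ m * d := by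
    rw [Finset.card_eq_sum_card_fiberwise (f := c) (t := Finset.univ) fun _ _ => by simp]
    simpa using Finset.sum_le_card_nsmul _ _ d hj
  have h4 : (I.card : ℝ) ≤ m * d := by exact_mod_cast h3
  refine h4.trans (mul_le_mul_of_nonneg_right ?_ d.cast_nonneg)
  have := Nat.floor_le (div_nonneg hΓ ht2.le)
  simp only [m, Nat.cast_add, Nat.cast_one]
  linarith

/-- A sum of numbers in `[0, 1]` of which at most `(Γ / t ^ 2 + 1) * d` exceed `t`. -/
theorem sum_le_of_card_large_le {ι : Type*} [DecidableEq ι] (b : ι → ℝ) {ω Γ d : ℝ} (hω : 0 < ω)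
    (hΓ : 0 ≤ Γ) (hd : 0 ≤ d) (s : Finset ι) (hb : ∀ k ∈ s, b k ≤ 1)
    (h : ∀ t, ω ≤ t → (Finset.card {k ∈ s | t < b k} : ℝ) ≤ (Γ / t ^ 2 + 1) * d) :
    ∑ k ∈ s, b k ≤ 2 * ω * s.card + 2 * d + 1 + 6 * Real.sqrt (d * Γ * s.card) := by
  -- Removing a smallest element `b k` replaces sorting. Its value must be paid for by the growth of
  -- the right-hand side in the cardinality, unless the whole sum is at most `2 d + 1`.
  induction s using Finset.strongInduction with
  | H s ih =>
    have hsq := Real.sqrt_nonneg (d * Γ * s.card)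
    rcases s.eq_empty_or_nonempty with rfl | hs
    · simp; linarith
    obtain ⟨k, hk, hmin⟩ := s.exists_min_image b hs
    have hcard : ((s.erase k).card : ℝ) = s.card - 1 := by
      rw [Finset.card_erase_of_mem hk, Nat.cast_sub (Finset.card_pos.2 hs), Nat.cast_one]
    have hn1 : (1 : ℝ) ≤ s.card := by exact_mod_cast Finset.card_pos.2 hs
    have ih' := ih (s.erase k) (Finset.erase_ssubset hk)
      (fun l hl => hb l (Finset.mem_of_mem_erase hl)) fun t ht => le_trans (by
        exact_mod_cast Finset.card_le_card (Finset.filter_subset_filter _ (s.erase_subset k)))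
        (h t ht)
    rw [hcard] at ih'
    rw [← Finset.add_sum_erase s b hk]
    by_cases hk1 : b k ≤ 2 * ω
    · have : Real.sqrt (d * Γ * (s.card - 1)) ≤ Real.sqrt (d * Γ * s.card) :=
        Real.sqrt_le_sqrt (mul_le_mul_of_nonneg_left (by linarith) (mul_nonneg hd hΓ))
      linarith
    push Not at hk1
    -- Half of the minimum is a level still above `ω` that every element, including the minimal one,
    -- strictly exceeds; the counting hypothesis therefore bounds the full cardinality.
    have hall : {l ∈ s | b k / 2 < b l} = s := Finset.filter_true_of_mem fun l hl => by
      linarith [hmin l hl]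
    have hc := h (b k / 2) (by linarith)
    rw [hall] at hc
    have hbk : 0 < b k := by linarith
    by_cases hnd : (s.card : ℝ) ≤ 2 * d + 1
    · have h5 : ∑ l ∈ s.erase k, b l ≤ s.card - 1 := by
        rw [← hcard]
        simpa using Finset.sum_le_card_nsmul (s.erase k) b 1
          fun l hl => hb l (Finset.mem_of_mem_erase hl)
      nlinarith [hb k hk]
    push Not at hnd
    have h6 : s.card * b k ^ 2 ≤ 8 * (d * Γ) := by
      have : (Γ / (b k / 2) ^ 2 + 1) * d = 4 * (d * Γ) / b k ^ 2 + d := by field_simp; ring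
      rw [this] at hc
      have h7 : (s.card : ℝ) / 2 ≤ 4 * (d * Γ) / b k ^ 2 := by linarith
      rw [le_div_iff₀ (by positivity)] at h7
      linarith
    -- With `q = d Γ` and `n` the cardinality, `n b² ≤ 8 q` gives `b √(q n) ≤ 3 q`, while the
    -- increment `√(q n) - √(q (n - 1))` is at least `q / (2 √(q n))`.
    have h8 : b k ≤ 6 * (Real.sqrt (d * Γ * s.card) - Real.sqrt (d * Γ * (s.card - 1))) := by
      set q := d * Γ
      have hq : 0 < q := by nlinarith [sq_pos_of_pos hbk]
      set n := (s.card : ℝ)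
      have hx := Real.sq_sqrt (show 0 ≤ q * n by positivity)
      have hy := Real.sq_sqrt (show 0 ≤ q * (n - 1) from mul_nonneg hq.le (by linarith))
      have hx0 : 0 < Real.sqrt (q * n) := Real.sqrt_pos.2 (by positivity)
      have hy0 := Real.sqrt_nonneg (q * (n - 1))
      set x := Real.sqrt (q * n)
      set y := Real.sqrt (q * (n - 1))
      have hyx : y ≤ x := by nlinarith
      have h9 : b k * x ≤ 3 * q := by
        refine abs_le_of_sq_le_sq' ?_ (by positivity) |>.2
        nlinarith
      have h10 : (x - y) * (x + y) = q := by ring_nf; linarith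
      have h11 : q ≤ (x - y) * (2 * x) := by nlinarith
      nlinarith
    linarith

theorem sum_abs_le_of_dimDE {ε Γ : ℝ} {d K : ℕ} (hd : dimDE Φ Λ ε ≤ d) (hε : 0 < ε)
    (hΓ : 0 ≤ Γ) {μ : Fin K → Measure X} {φ : Fin K → X → ℝ} (I : Finset (Fin K))
    (hμ : ∀ k, μ k ∈ Λ) (hφ : ∀ k, φ k ∈ Φ)
    (h1 : ∀ k ∈ I, ∑ i ∈ Finset.Iio k, (∫ x, φ k x ∂μ i) ^ 2 ≤ Γ)
    (h2 : ∀ k, |∫ x, φ k x ∂μ k| ≤ 1) :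
    ∑ k ∈ I, |∫ x, φ k x ∂μ k| ≤ 2 * ε * K + 2 * d + 1 + 6 * Real.sqrt (d * Γ * K) := by
  have hcard : (I.card : ℝ) ≤ K := by exact_mod_cast I.card_le_univ.trans (by simp)
  refine (sum_le_of_card_large_le _ hε hΓ d.cast_nonneg I (fun k _ => h2 k) fun t ht => ?_).trans ?_
  · refine card_large_le hd ht (hε.trans_le ht) hΓ _ hμ hφ
      (fun k hk => h1 k (Finset.mem_filter.1 hk).1) fun k hk => (Finset.mem_filter.1 hk).2
  · have : Real.sqrt (d * Γ * I.card) ≤ Real.sqrt (d * Γ * K) :=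
      Real.sqrt_le_sqrt (mul_le_mul_of_nonneg_left hcard (by positivity))
    nlinarith

end Eluder

/-- `g` is measurable with values in `[0, 1]`. -/
def UnitValued {S A : Type*} [MeasurableSpace S] [MeasurableSpace A] (g : S → A → ℝ) : Prop :=
  Measurable (Function.uncurry g) ∧ ∀ s a, g s a ∈ Set.Icc (0 : ℝ) 1

/-! ### Maxima over the actions -/

noncomputable section Maximum

variable {S A : Type*}

/-- The value `max_a g(s, a)`. -/
def mx (g : S → A → ℝ) (s : S) : ℝ := ⨆ a, g s a

variable [Fintype A] [Nonempty A]

theorem le_mx (g : S → A → ℝ) (s : S) (a : A) : g s a ≤ mx g s :=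
  le_ciSup (Set.finite_range (g s)).bddAbove a

theorem mx_le {g : S → A → ℝ} {s : S} {c : ℝ} (h : ∀ a, g s a ≤ c) : mx g s ≤ c := ciSup_le h

theorem mx_eq {g : S → A → ℝ} {s : S} {a : A} (h : ∀ a', g s a' ≤ g s a) : mx g s = g s a :=
  le_antisymm (mx_le h) (le_mx g s a)

theorem mx_sub_le {g g' : S → A → ℝ} {s : S} {ρ : ℝ} (h : ∀ a, |g s a - g' s a| ≤ ρ) :
    |mx g s - mx g' s| ≤ ρ := by
  have h1 : mx g s ≤ mx g' s + ρ := mx_le fun a => by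
    linarith [(abs_le.1 (h a)).2, le_mx g' s a]
  have h2 : mx g' s ≤ mx g s + ρ := mx_le fun a => by
    linarith [(abs_le.1 (h a)).1, le_mx g s a]
  exact abs_le.2 ⟨by linarith, by linarith⟩

variable [MeasurableSpace S] [MeasurableSpace A]

theorem UnitValued.mx_mem {g : S → A → ℝ} (hg : UnitValued g) (s : S) :
    mx g s ∈ Set.Icc (0 : ℝ) 1 :=
  ⟨(hg.2 s (Classical.arbitrary A)).1.trans (le_mx g s _), mx_le fun a => (hg.2 s a).2⟩

theorem measurable_mx_param {Ω : Type*} [MeasurableSpace Ω] {g : Ω → S → A → ℝ}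
    (hg : Measurable fun p : Ω × S × A => g p.1 p.2.1 p.2.2) :
    Measurable (Function.uncurry fun ω => mx (g ω)) :=
  Measurable.iSup fun _ =>
    hg.comp (measurable_fst.prodMk (measurable_snd.prodMk measurable_const))

theorem UnitValued.measurable_mx {g : S → A → ℝ} (hg : UnitValued g) : Measurable (mx g) :=
  Measurable.iSup fun _ => hg.1.comp (measurable_id.prodMk measurable_const)

theorem UnitValued.zero : UnitValued (0 : S → A → ℝ) :=
  ⟨measurable_const, fun _ _ => by simp⟩

theorem UnitValued.integral_mx_mem {g : S → A → ℝ} (hg : UnitValued g) (μ : Measure S)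
    [IsProbabilityMeasure μ] : ∫ s, mx g s ∂μ ∈ Set.Icc (0 : ℝ) 1 := by
  refine ⟨integral_nonneg fun s => (hg.mx_mem s).1, ?_⟩
  have hi : Integrable (mx g) μ := Integrable.of_bound hg.measurable_mx.aestronglyMeasurable 1
    (.of_forall fun s => by
      rw [Real.norm_eq_abs, abs_of_nonneg (hg.mx_mem s).1]; exact (hg.mx_mem s).2)
  simpa using integral_mono hi (integrable_const (1 : ℝ)) fun s => (hg.mx_mem s).2

theorem UnitValued.integrable_mx {g : S → A → ℝ} (hg : UnitValued g) (μ : Measure S)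
    [IsProbabilityMeasure μ] : Integrable (mx g) μ :=
  Integrable.of_bound hg.measurable_mx.aestronglyMeasurable 1 (.of_forall fun s => by
    rw [Real.norm_eq_abs, abs_of_nonneg (hg.mx_mem s).1]; exact (hg.mx_mem s).2)

end Maximum

noncomputable section

namespace MDP

variable {S A : Type*} [MeasurableSpace S] [MeasurableSpace A] (M : MDP S A)

instance isMarkovKernel_P (h : ℕ) : IsMarkovKernel (M.P h) := M.markov h

/-! ### Laws of states, of observed tuples and of epochs -/

section StateLaw

theorem isProbabilityMeasure_stateLaw {π : ℕ → S → A} {h : ℕ} (s : S) {n : ℕ}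
    (hπ : ∀ m < n, Measurable (π (h + m))) : IsProbabilityMeasure (M.stateLaw π h s n) := by
  induction n with
  | zero => rw [stateLaw]; infer_instance
  | succ n ih =>
    have := ih fun m hm => hπ m (by omega)
    exact isProbabilityMeasure_bind'
      ((M.P (h + n)).measurable.comp (measurable_id.prodMk (hπ n n.lt_succ_self)))
      fun _ => inferInstance

theorem measurable_stateLaw {Ω : Type*} [MeasurableSpace Ω] {π : Ω → ℕ → S → A} {h : ℕ} (s : S)
    {n : ℕ} (hπ : ∀ m < n, Measurable fun p : Ω × S => π p.1 (h + m) p.2) :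
    Measurable fun ω => M.stateLaw (π ω) h s n := by
  induction n with
  | zero => exact measurable_const
  | succ n ih =>
    refine measurable_bind_param (ih fun m hm => hπ m (by omega)) (fun ω => ?_)
      (η := fun ω s' => M.P (h + n) (s', π ω (h + n) s'))
      ((M.P (h + n)).measurable.comp (measurable_snd.prodMk (hπ n n.lt_succ_self)))
    exact M.isProbabilityMeasure_stateLaw s fun m hm =>
      (hπ m (by omega)).comp measurable_prodMk_left

theorem integral_stateLaw_succ {π : ℕ → S → A} {h : ℕ} (s : S) {n : ℕ}
    (hπ : ∀ m ≤ n, Measurable (π (h + m))) {u : S → ℝ} (hu : Measurable u) {b : ℝ}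
    (hb : ∀ s, |u s| ≤ b) :
    ∫ s', u s' ∂M.stateLaw π h s (n + 1) =
      ∫ s', ∫ s'', u s'' ∂M.P (h + n) (s', π (h + n) s') ∂M.stateLaw π h s n := by
  let κ : Kernel S S := ⟨fun s' => M.P (h + n) (s', π (h + n) s'),
    (M.P (h + n)).measurable.comp (measurable_id.prodMk (hπ n le_rfl))⟩
  have : IsMarkovKernel κ := ⟨fun s' => inferInstanceAs
    (IsProbabilityMeasure (M.P (h + n) (s', π (h + n) s')))⟩
  have h1 := M.isProbabilityMeasure_stateLaw s (n := n) fun m hm => hπ m hm.le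
  have h2 := M.isProbabilityMeasure_stateLaw s (n := n + 1) fun m hm => hπ m (by omega)
  exact Kernel.integral_comp (κ := Kernel.const Unit (M.stateLaw π h s n)) (η := κ) (a := ())
    (Integrable.of_bound (μ := M.stateLaw π h s (n + 1)) hu.aestronglyMeasurable b
      (.of_forall hb))

end StateLaw

section TupleLaw

variable [MeasurableSingletonClass A] [Fintype A] [Nonempty A]

theorem measurable_observation (h : ℕ) : Measurable fun s : S =>
    (uniformOn (Set.univ : Set A)).bind fun a =>
      (M.P h (s, a)).map fun s' => (s, a, M.r h s a, s') := by
  refine measurable_bind_param (measurable_const (a := uniformOn (Set.univ : Set A)))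
    (fun _ => inferInstance)
    (η := fun s a => (M.P h (s, a)).map fun s' => (s, a, M.r h s a, s')) ?_
  refine measurable_map_param (κ := fun p : S × A => M.P h p)
    (g := fun p s' => (p.1, p.2, M.r h p.1 p.2, s')) (M.P h).measurable (fun _ => inferInstance) ?_
  exact measurable_fst.fst.prodMk (measurable_fst.snd.prodMk
    (((M.r_measurable h).comp measurable_fst).prodMk measurable_snd))

theorem measurable_observation_map (h : ℕ) (s : S) (a : A) :
    Measurable fun s' : S => (s, a, M.r h s a, s') :=
  measurable_const.prodMk (measurable_const.prodMk (measurable_const.prodMk measurable_id))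

theorem measurable_observation_right (h : ℕ) (s : S) : Measurable fun a : A =>
    (M.P h (s, a)).map fun s' => (s, a, M.r h s a, s') :=
  measurable_of_finite _

theorem isProbabilityMeasure_observation (h : ℕ) (s : S) : IsProbabilityMeasure
    ((uniformOn (Set.univ : Set A)).bind fun a =>
      (M.P h (s, a)).map fun s' => (s, a, M.r h s a, s')) :=
  isProbabilityMeasure_bind' (M.measurable_observation_right h s) fun a =>
    Measure.isProbabilityMeasure_map (M.measurable_observation_map h s a).aemeasurable

theorem lintegral_tupleLaw {π : ℕ → S → A} {h : ℕ}
    {F : S × A × ℝ × S → ℝ≥0∞} (hF : Measurable F) :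
    ∫⁻ z, F z ∂M.tupleLaw π h = ∫⁻ s, (Fintype.card A : ℝ≥0∞)⁻¹ *
      ∑ a, ∫⁻ s', F (s, a, M.r h s a, s') ∂M.P h (s, a) ∂M.stateLaw π 0 M.s₁ h := by
  rw [tupleLaw, Measure.lintegral_bind (M.measurable_observation h).aemeasurable hF.aemeasurable]
  refine lintegral_congr fun s => ?_
  rw [Measure.lintegral_bind (M.measurable_observation_right h s).aemeasurable hF.aemeasurable,
    lintegral_uniformOn_univ]
  simp_rw [lintegral_map hF (M.measurable_observation_map h s _)]

theorem lintegral_tupleLaw_fst {π : ℕ → S → A} {h : ℕ} {F : S → ℝ≥0∞} (hF : Measurable F) :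
    ∫⁻ z, F z.1 ∂M.tupleLaw π h = ∫⁻ s, F s ∂M.stateLaw π 0 M.s₁ h := by
  refine (M.lintegral_tupleLaw (hF.comp measurable_fst)).trans ?_
  refine lintegral_congr fun s => ?_
  simp only [Function.comp_apply, lintegral_const, measure_univ, mul_one, Finset.sum_const, Finset.card_univ,
    nsmul_eq_mul]
  rw [← mul_assoc, ENNReal.inv_mul_cancel (by simp) (by simp), one_mul]

theorem isProbabilityMeasure_tupleLaw {π : ℕ → S → A} {h : ℕ} (hπ : ∀ m < h, Measurable (π m)) :
    IsProbabilityMeasure (M.tupleLaw π h) := by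
  have := M.isProbabilityMeasure_stateLaw (h := 0) M.s₁ (n := h) (π := π) (by simpa using hπ)
  exact isProbabilityMeasure_bind' (M.measurable_observation h)
    (M.isProbabilityMeasure_observation h)

theorem measurable_tupleLaw {Ω : Type*} [MeasurableSpace Ω] {π : Ω → ℕ → S → A} {h : ℕ}
    (hπ : ∀ m < h, Measurable fun p : Ω × S => π p.1 m p.2) :
    Measurable fun ω => M.tupleLaw (π ω) h :=
  measurable_bind_param (M.measurable_stateLaw (h := 0) M.s₁ (by simpa using hπ))
    (fun ω => M.isProbabilityMeasure_stateLaw (h := 0) M.s₁ fun m hm => by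
      rw [zero_add]; exact (hπ m hm).comp measurable_prodMk_left)
    ((M.measurable_observation h).comp measurable_snd)

theorem isProbabilityMeasure_epochLaw {π : ℕ → S → A} (hπ : ∀ m < M.H, Measurable (π m)) :
    IsProbabilityMeasure (M.epochLaw π) := by
  have := fun h : Fin M.H => M.isProbabilityMeasure_tupleLaw (h := h) fun m hm =>
    hπ m (hm.trans h.2)
  unfold epochLaw
  infer_instance

theorem measurable_epochLaw {Ω : Type*} [MeasurableSpace Ω] {π : Ω → ℕ → S → A}
    (hπ : ∀ m < M.H, Measurable fun p : Ω × S => π p.1 m p.2) :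
    Measurable fun ω => M.epochLaw (π ω) :=
  measurable_pi_param (fun h => M.measurable_tupleLaw fun m hm => hπ m (hm.trans h.2))
    fun _ h => M.isProbabilityMeasure_tupleLaw fun m hm =>
      (hπ m (hm.trans h.2)).comp measurable_prodMk_left

theorem lintegral_epochLaw_eval {π : ℕ → S → A} (hπ : ∀ m < M.H, Measurable (π m)) (h : Fin M.H)
    {F : S × A × ℝ × S → ℝ≥0∞} (hF : Measurable F) :
    ∫⁻ e, F (e h) ∂M.epochLaw π = ∫⁻ z, F z ∂M.tupleLaw π h := by
  have := fun h : Fin M.H => M.isProbabilityMeasure_tupleLaw (h := h) fun m hm =>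
    hπ m (hm.trans h.2)
  exact (measurePreserving_eval (fun h : Fin M.H => M.tupleLaw π h) h).lintegral_comp hF

end TupleLaw

/-! ### Excess loss, squared residuals and the exponential moment -/

section Bellman

variable [Fintype A] [Nonempty A]

theorem bellman_eq (h : ℕ) (g : S → A → ℝ) (s : S) (a : A) :
    M.bellman h g s a = M.r h s a + ∫ s', mx g s' ∂M.P h (s, a) := rfl

theorem measurable_bellman_param {Ω : Type*} [MeasurableSpace Ω] {g : Ω → S → A → ℝ}
    (hg : Measurable fun p : Ω × S × A => g p.1 p.2.1 p.2.2) (h : ℕ) :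
    Measurable fun p : Ω × S × A => M.bellman h (g p.1) p.2.1 p.2.2 := by
  refine ((M.r_measurable h).comp measurable_snd).add ?_
  refine measurable_integral_param (κ := fun p : Ω × S × A => M.P h p.2)
    (g := fun p s' => mx (g p.1) s') ((M.P h).measurable.comp measurable_snd)
    (fun _ => inferInstance) ?_
  exact (measurable_mx_param hg).comp (measurable_fst.fst.prodMk measurable_snd)

theorem measurable_bellman {g : S → A → ℝ} (hg : UnitValued g) (h : ℕ) :
    Measurable (Function.uncurry (M.bellman h g)) :=
  (M.measurable_bellman_param (Ω := Unit) (g := fun _ => g) (hg.1.comp measurable_snd) h).comp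
    (measurable_const (a := ()) |>.prodMk measurable_id)

theorem bellman_sub_le {g g' : S → A → ℝ} (hg : UnitValued g) (hg' : UnitValued g') {ρ : ℝ}
    (h : ℕ) (hρ : ∀ s a, |g s a - g' s a| ≤ ρ) (s : S) (a : A) :
    |M.bellman h g s a - M.bellman h g' s a| ≤ ρ := by
  rw [bellman_eq, bellman_eq, add_sub_add_left_eq_sub,
    ← integral_sub (hg.integrable_mx _) (hg'.integrable_mx _)]
  have := norm_integral_le_of_norm_le_const (μ := M.P h (s, a)) (f := fun s' => mx g s' - mx g' s')
    (.of_forall fun s' => mx_sub_le (hρ s'))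
  simpa using this

/-- Squared loss of `ξ` minus squared loss of the Bellman backup of `ζ`, for targets built from `ζ`,
at one observed tuple. -/
def excess (h : ℕ) (ξ ζ : S → A → ℝ) (z : S × A × ℝ × S) : ℝ :=
  (ξ z.1 z.2.1 - z.2.2.1 - mx ζ z.2.2.2) ^ 2 -
    (M.bellman h ζ z.1 z.2.1 - z.2.2.1 - mx ζ z.2.2.2) ^ 2

/-- Squared Bellman residual at a state, averaged over the actions. -/
def meanSq (h : ℕ) (ξ ζ : S → A → ℝ) (s : S) : ℝ :=
  (Fintype.card A : ℝ)⁻¹ * ∑ a, (ξ s a - M.bellman h ζ s a) ^ 2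

/-- The point mass at `s` (for `b = true`) or the law of the state at step `h` under `π`. -/
def evalLaw (b : Bool) (π : ℕ → S → A) (h : ℕ) (s : S) : Measure S :=
  if b then Measure.dirac s else M.stateLaw π 0 M.s₁ h

variable {M} {h : ℕ} {ξ ζ ξ' ζ' : S → A → ℝ}

/-- The bound `2` rather than `1` is deliberate: cover centres may be tuples from `G`, whose backups
are not controlled by completeness. -/
theorem bellman_mem (hr : ∀ s a, M.r h s a ≤ 1) (hζ : UnitValued ζ) (s : S) (a : A) :
    M.bellman h ζ s a ∈ Set.Icc (0 : ℝ) 2 := by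
  have := hζ.integral_mx_mem (M.P h (s, a))
  have h1 := hr s a
  have h2 := M.r_nonneg h s a
  rw [bellman_eq]
  exact ⟨by linarith [this.1], by linarith [this.2]⟩

theorem measurable_excess (hξ : UnitValued ξ) (hζ : UnitValued ζ) :
    Measurable (M.excess h ξ ζ) := by
  have h1 : Measurable fun z : S × A × ℝ × S => (z.1, z.2.1) :=
    measurable_fst.prodMk measurable_snd.fst
  have h2 : Measurable fun z : S × A × ℝ × S => mx ζ z.2.2.2 :=
    hζ.measurable_mx.comp measurable_snd.snd.snd
  exact ((((hξ.1.comp h1).sub measurable_snd.snd.fst).sub h2).pow_const 2).sub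
    (((((M.measurable_bellman hζ h).comp h1).sub measurable_snd.snd.fst).sub h2).pow_const 2)

variable [MeasurableSingletonClass A]

theorem measurable_meanSq (hξ : UnitValued ξ) (hζ : UnitValued ζ) :
    Measurable (M.meanSq h ξ ζ) :=
  (Finset.measurable_sum _ fun _ _ => ((hξ.1.comp (measurable_id.prodMk measurable_const)).sub
    ((M.measurable_bellman hζ h).comp (measurable_id.prodMk measurable_const))).pow_const
      2).const_mul _

theorem meanSq_mem (hr : ∀ s a, M.r h s a ≤ 1) (hξ : UnitValued ξ) (hζ : UnitValued ζ) (s : S) :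
    M.meanSq h ξ ζ s ∈ Set.Icc (0 : ℝ) 4 := by
  have hc : (0 : ℝ) < Fintype.card A := by exact_mod_cast Fintype.card_pos
  refine ⟨mul_nonneg (inv_nonneg.2 hc.le) (Finset.sum_nonneg fun _ _ => sq_nonneg _), ?_⟩
  rw [meanSq, inv_mul_le_iff₀ hc]
  have : ∑ a, (ξ s a - M.bellman h ζ s a) ^ 2 ≤ ∑ _a : A, (4 : ℝ) :=
    Finset.sum_le_sum fun a _ => by
      have h1 := bellman_mem hr hζ s a
      have h2 := hξ.2 s a
      nlinarith [h1.1, h1.2, h2.1, h2.2]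
  simpa [mul_comm] using this

theorem integrable_meanSq (hr : ∀ s a, M.r h s a ≤ 1) (hξ : UnitValued ξ) (hζ : UnitValued ζ)
    (μ : Measure S) [IsProbabilityMeasure μ] : Integrable (M.meanSq h ξ ζ) μ :=
  Integrable.of_bound (measurable_meanSq hξ hζ).aestronglyMeasurable 4 (.of_forall fun s => by
    rw [Real.norm_eq_abs, abs_of_nonneg (meanSq_mem hr hξ hζ s).1]
    exact (meanSq_mem hr hξ hζ s).2)

/-- Conditionally on the state and the action, the excess loss has an exponential moment below `1`
by a margin proportional to the squared residual. -/
theorem lintegral_exp_excess_le (hr : ∀ s a, M.r h s a ≤ 1) (hξ : UnitValued ξ)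
    (hζ : UnitValued ζ) (s : S) (a : A) :
    ∫⁻ s', ENNReal.ofReal (Real.exp (-(M.excess h ξ ζ (s, a, M.r h s a, s') / 8))) ∂M.P h (s, a) ≤
      ENNReal.ofReal (1 - (ξ s a - M.bellman h ζ s a) ^ 2 / 32) := by
  set e := ξ s a - M.bellman h ζ s a with he
  set v := ∫ s', mx ζ s' ∂M.P h (s, a) with hv
  have hvm := hζ.integral_mx_mem (M.P h (s, a))
  have hB : M.bellman h ζ s a = M.r h s a + v := rfl
  have hBm := bellman_mem hr hζ s a
  have hξm := hξ.2 s a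
  have he2 : |e| ≤ 2 := abs_le.2 ⟨by linarith [hBm.2, hξm.1], by linarith [hBm.1, hξm.2]⟩
  have hesq : e ^ 2 ≤ 4 := by nlinarith [abs_le.1 he2]
  -- The excess is `e² + 2 e η` with `η` of mean zero. Since `|e η / 4| ≤ 1`, the bound `exp x ≤ 1 +
  -- x + x²` applies to `x = -e η / 4`; the linear term is kept because it vanishes on integration,
  -- and `x² ≤ e² / 16`.
  have hpt : ∀ s', Real.exp (-(M.excess h ξ ζ (s, a, M.r h s a, s') / 8)) ≤
      Real.exp (-(e ^ 2 / 8)) * (1 + e ^ 2 / 16 - e / 4 * (v - mx ζ s')) := by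
    intro s'
    have hm := hζ.mx_mem s'
    set η := v - mx ζ s' with hη
    have hη1 : |η| ≤ 1 := abs_le.2 ⟨by linarith [hvm.1, hm.2], by linarith [hvm.2, hm.1]⟩
    have hex : M.excess h ξ ζ (s, a, M.r h s a, s') = e ^ 2 + 2 * e * η := by
      simp only [excess]
      rw [show ξ s a = e + (M.r h s a + v) by rw [he, hB]; ring, hB, hη]
      ring
    have hprod : |e * η| ≤ 2 := by
      rw [abs_mul]; nlinarith [abs_nonneg e, abs_nonneg η]
    have hx : |-(e / 4 * η)| ≤ 1 := by
      rw [abs_neg, show e / 4 * η = e * η / 4 by ring, abs_div, abs_of_pos (by norm_num : (0 : ℝ) < 4)]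
      linarith
    have hexp := (abs_le.1 (Real.abs_exp_sub_one_sub_id_le hx)).2
    have hη2 : η ^ 2 ≤ 1 := by nlinarith [abs_le.1 hη1]
    rw [hex, show -((e ^ 2 + 2 * e * η) / 8) = -(e ^ 2 / 8) + -(e / 4 * η) by ring, Real.exp_add]
    refine mul_le_mul_of_nonneg_left ?_ (Real.exp_pos _).le
    nlinarith [sq_nonneg e, mul_nonneg (sq_nonneg e) (sub_nonneg.2 hη2)]
  refine (lintegral_mono fun s' => ENNReal.ofReal_le_ofReal (hpt s')).trans ?_
  have hi := hζ.integrable_mx (M.P h (s, a))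
  have hi1 : Integrable (fun s' => e / 4 * (v - mx ζ s')) (M.P h (s, a)) :=
    ((integrable_const _).sub hi).const_mul _
  have hi2 : Integrable (fun s' => Real.exp (-(e ^ 2 / 8)) *
      (1 + e ^ 2 / 16 - e / 4 * (v - mx ζ s'))) (M.P h (s, a)) :=
    ((integrable_const _).sub hi1).const_mul _
  rw [← ofReal_integral_eq_lintegral_ofReal hi2
    (.of_forall fun s' => (Real.exp_pos _).le.trans (hpt s'))]
  refine ENNReal.ofReal_le_ofReal ?_
  rw [integral_const_mul, integral_sub (integrable_const _) hi1,
    integral_const_mul, integral_sub (integrable_const _) hi, ← hv]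
  simp only [integral_const, probReal_univ, one_smul, sub_self, mul_zero, sub_zero]
  have hx : |-(e ^ 2 / 16)| ≤ 1 := by
    rw [abs_neg, abs_of_nonneg (by positivity)]; linarith
  have hexp := (abs_le.1 (Real.abs_exp_sub_one_sub_id_le hx)).2
  have h1 : 1 + e ^ 2 / 16 ≤ Real.exp (e ^ 2 / 16) := by
    linarith [Real.add_one_le_exp (e ^ 2 / 16)]
  -- The drift `e² / 8` beats the variance term `e² / 16`; half of the difference `e² / 16` survives
  -- the second-order error in expanding the exponential because `e² ≤ 4`.
  calc Real.exp (-(e ^ 2 / 8)) * (1 + e ^ 2 / 16)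
      ≤ Real.exp (-(e ^ 2 / 8)) * Real.exp (e ^ 2 / 16) :=
        mul_le_mul_of_nonneg_left h1 (Real.exp_pos _).le
    _ = Real.exp (-(e ^ 2 / 16)) := by rw [← Real.exp_add]; ring_nf
    _ ≤ 1 - e ^ 2 / 32 := by nlinarith [sq_nonneg e]

theorem inv_card_mul_sum_lintegral_le (hr : ∀ s a, M.r h s a ≤ 1) (hξ : UnitValued ξ)
    (hζ : UnitValued ζ) (s : S) :
    (Fintype.card A : ℝ≥0∞)⁻¹ * ∑ a, ∫⁻ s', ENNReal.ofReal
      (Real.exp (-(M.excess h ξ ζ (s, a, M.r h s a, s') / 8))) ∂M.P h (s, a) ≤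
      ENNReal.ofReal (1 - M.meanSq h ξ ζ s / 32) := by
  have hc : (0 : ℝ) < Fintype.card A := by exact_mod_cast Fintype.card_pos
  have hnn : ∀ a, 0 ≤ 1 - (ξ s a - M.bellman h ζ s a) ^ 2 / 32 := fun a => by
    have h1 := bellman_mem hr hζ s a
    have h2 := hξ.2 s a
    nlinarith [h1.1, h1.2, h2.1, h2.2]
  refine (mul_le_mul_right (Finset.sum_le_sum fun a _ =>
    lintegral_exp_excess_le hr hξ hζ s a) _).trans (le_of_eq ?_)
  rw [← ENNReal.ofReal_sum_of_nonneg fun a _ => hnn a,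
    show (Fintype.card A : ℝ≥0∞)⁻¹ = ENNReal.ofReal ((Fintype.card A : ℝ)⁻¹) by
      rw [ENNReal.ofReal_inv_of_pos hc, ENNReal.ofReal_natCast],
    ← ENNReal.ofReal_mul (inv_nonneg.2 hc.le)]
  congr 1
  rw [Finset.sum_sub_distrib, ← Finset.sum_div, meanSq]
  simp only [Finset.sum_const, Finset.card_univ, nsmul_eq_mul, mul_one]
  field_simp

theorem measurable_evalLaw {Ω : Type*} [MeasurableSpace Ω] (b : Bool) {π : Ω → ℕ → S → A}
    (hπ : ∀ m < h, Measurable fun p : Ω × S => π p.1 m p.2) {s : Ω → S} (hs : Measurable s) :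
    Measurable fun ω => M.evalLaw b (π ω) h (s ω) := by
  cases b
  · simpa [evalLaw] using M.measurable_stateLaw (h := 0) M.s₁ (by simpa using hπ)
  · simpa [evalLaw, Function.comp_def] using Measure.measurable_dirac.comp hs

theorem isProbabilityMeasure_evalLaw (b : Bool) {π : ℕ → S → A}
    (hπ : ∀ m < h, Measurable (π m)) (s : S) : IsProbabilityMeasure (M.evalLaw b π h s) := by
  cases b
  · simpa [evalLaw] using M.isProbabilityMeasure_stateLaw (h := 0) M.s₁ (by simpa using hπ)
  · simp only [evalLaw, if_true]; infer_instance

/-- Averaging over next state and action, with the state fixed, leaves the factor `1 - m(s) / 32`,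
where `m` is the mean squared residual. The compensator is `m(s)` itself at a point mass and the
mean of `m` under the roll-in law; either way `exp x * (1 - x) ≤ 1` concludes. -/
theorem lintegral_exp_tupleLaw_le (b : Bool) {π : ℕ → S → A} (hπ : ∀ m < h, Measurable (π m))
    (hr : ∀ s a, M.r h s a ≤ 1) (hξ : UnitValued ξ) (hζ : UnitValued ζ) :
    ∫⁻ z, ENNReal.ofReal (Real.exp ((∫ s, M.meanSq h ξ ζ s ∂M.evalLaw b π h z.1) / 32 -
      M.excess h ξ ζ z / 8)) ∂M.tupleLaw π h ≤ 1 := by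
  have hc : Measurable fun s => ∫ s', M.meanSq h ξ ζ s' ∂M.evalLaw b π h s :=
    measurable_integral_param (κ := fun s => M.evalLaw b π h s)
      (g := fun _ s' => M.meanSq h ξ ζ s')
      (measurable_evalLaw b (π := fun _ => π) (fun m hm => (hπ m hm).comp measurable_snd)
        measurable_id)
      (isProbabilityMeasure_evalLaw b hπ) ((measurable_meanSq hξ hζ).comp measurable_snd)
  refine (M.lintegral_tupleLaw (ENNReal.measurable_ofReal.comp (Real.measurable_exp.comp
    (((hc.comp measurable_fst).div_const 32).sub
      ((measurable_excess hξ hζ).div_const 8))))).trans_le ?_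
  have hp := M.isProbabilityMeasure_stateLaw (h := 0) M.s₁ (n := h) (π := π) (by simpa using hπ)
  have h1 : ∀ s, (Fintype.card A : ℝ≥0∞)⁻¹ * ∑ a, ∫⁻ s', ENNReal.ofReal (Real.exp
      ((∫ s', M.meanSq h ξ ζ s' ∂M.evalLaw b π h s) / 32 -
        M.excess h ξ ζ (s, a, M.r h s a, s') / 8)) ∂M.P h (s, a) ≤
      ENNReal.ofReal (Real.exp ((∫ s', M.meanSq h ξ ζ s' ∂M.evalLaw b π h s) / 32)) *
        ENNReal.ofReal (1 - M.meanSq h ξ ζ s / 32) := by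
    intro s
    refine le_trans (le_of_eq ?_) (mul_le_mul_right
      (inv_card_mul_sum_lintegral_le hr hξ hζ s) _)
    simp_rw [sub_eq_add_neg, Real.exp_add, ENNReal.ofReal_mul (Real.exp_pos _).le]
    have hm : ∀ a, Measurable fun s' => ENNReal.ofReal (Real.exp
        (-(M.excess h ξ ζ (s, a, M.r h s a, s') / 8))) := fun a =>
      ENNReal.measurable_ofReal.comp (Real.measurable_exp.comp
        (((measurable_excess hξ hζ).comp (M.measurable_observation_map h s a)).div_const 8).neg)
    simp_rw [lintegral_const_mul _ (hm _)]
    rw [← Finset.mul_sum, mul_left_comm]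
  refine (lintegral_mono h1).trans ?_
  have hexp : ∀ x : ℝ, ENNReal.ofReal (Real.exp x) * ENNReal.ofReal (1 - x) ≤ 1 := fun x => by
    rw [← ENNReal.ofReal_mul (Real.exp_pos _).le, ← ENNReal.ofReal_one]
    refine ENNReal.ofReal_le_ofReal ?_
    have := Real.add_one_le_exp (-x)
    calc Real.exp x * (1 - x) ≤ Real.exp x * Real.exp (-x) :=
          mul_le_mul_of_nonneg_left (by linarith) (Real.exp_pos _).le
      _ = 1 := by rw [← Real.exp_add]; simp
  -- For the roll-in law the compensator is constant, so the state is integrated out before the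
  -- inequality is used; for point masses the inequality is used at each state.
  cases b
  · simp only [evalLaw, Bool.false_eq_true, if_false]
    have hi := integrable_meanSq hr hξ hζ (M.stateLaw π 0 M.s₁ h)
    have hm : Measurable fun s => ENNReal.ofReal (1 - M.meanSq h ξ ζ s / 32) :=
      ENNReal.measurable_ofReal.comp
        (measurable_const.sub ((measurable_meanSq hξ hζ).div_const 32))
    have hi1 : Integrable (fun s => 1 - M.meanSq h ξ ζ s / 32) (M.stateLaw π 0 M.s₁ h) :=
      (integrable_const _).sub (hi.div_const 32)
    rw [lintegral_const_mul _ hm, ← ofReal_integral_eq_lintegral_ofReal hi1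
        (.of_forall fun s => by
          have := (meanSq_mem hr hξ hζ s).2
          simp only [Pi.zero_apply]; linarith),
      integral_sub (integrable_const _) (hi.div_const 32), integral_div]
    simpa using hexp _
  · simp only [evalLaw, if_true]
    refine (lintegral_mono (g := fun _ => 1) fun s => ?_).trans (by simp)
    rw [integral_dirac' _ _ (measurable_meanSq hξ hζ).stronglyMeasurable]
    exact hexp _

end Bellman

end MDP

end

noncomputable section

namespace MDP

variable {S A : Type*} [MeasurableSpace S] [MeasurableSpace A] {M : MDP S A}

/-! ### Telescoping of values, Bellman's optimality equation and optimism -/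

section Telescoping

/-- Temporal difference of the state function `u` under the policy `π`. -/
def td (M : MDP S A) (π : ℕ → S → A) (u : ℕ → S → ℝ) (h : ℕ) (s : S) : ℝ :=
  u h s - M.r h s (π h s) - ∫ s', u (h + 1) s' ∂M.P h (s, π h s)

variable {π : ℕ → S → A} {u : ℕ → S → ℝ} {b : ℝ}

theorem measurable_reward (hπ : ∀ h < M.H, Measurable (π h)) {h : ℕ} (hh : h < M.H) :
    Measurable fun s => M.r h s (π h s) :=
  (M.r_measurable h).comp (measurable_id.prodMk (hπ h hh))

theorem integrable_reward (hr : ∀ h < M.H, ∀ s a, M.r h s a ≤ 1)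
    (hπ : ∀ h < M.H, Measurable (π h)) {h : ℕ} (hh : h < M.H) (μ : Measure S)
    [IsProbabilityMeasure μ] : Integrable (fun s => M.r h s (π h s)) μ :=
  Integrable.of_bound (measurable_reward hπ hh).aestronglyMeasurable 1 (.of_forall fun s => by
    rw [Real.norm_eq_abs, abs_of_nonneg (M.r_nonneg _ _ _)]; exact hr h hh _ _)

theorem sum_integral_td (hr : ∀ h < M.H, ∀ s a, M.r h s a ≤ 1)
    (hπ : ∀ h < M.H, Measurable (π h)) (hu : ∀ h, Measurable (u h)) (hb : ∀ h s, |u h s| ≤ b)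
    (h : ℕ) (s : S) : ∀ n, h + n ≤ M.H →
    ∑ i ∈ Finset.range n, ∫ s', M.td π u (h + i) s' ∂M.stateLaw π h s i =
      u h s - ∑ i ∈ Finset.range n, ∫ s', M.r (h + i) s' (π (h + i) s') ∂M.stateLaw π h s i -
        ∫ s', u (h + n) s' ∂M.stateLaw π h s n := by
  intro n
  induction n with
  | zero =>
    intro _
    simp [stateLaw, integral_dirac' _ s (hu h).stronglyMeasurable]
  | succ n ih =>
    intro hn
    have hπn : ∀ m ≤ n, Measurable (π (h + m)) := fun m hm => hπ _ (by omega)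
    have hp := M.isProbabilityMeasure_stateLaw s (n := n) fun m hm => hπn m hm.le
    have hiu : Integrable (u (h + n)) (M.stateLaw π h s n) :=
      Integrable.of_bound (hu _).aestronglyMeasurable b (.of_forall (hb _))
    have hir := integrable_reward hr hπ (show h + n < M.H by omega) (M.stateLaw π h s n)
    have hm : Measurable fun s' => ∫ s'', u (h + n + 1) s'' ∂M.P (h + n) (s', π (h + n) s') :=
      measurable_integral_param (κ := fun s' => M.P (h + n) (s', π (h + n) s'))
        (g := fun _ s'' => u (h + n + 1) s'')
        ((M.P (h + n)).measurable.comp (measurable_id.prodMk (hπn n le_rfl)))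
        (fun _ => inferInstance) ((hu _).comp measurable_snd)
    have hiP : Integrable (fun s' => ∫ s'', u (h + n + 1) s'' ∂M.P (h + n) (s', π (h + n) s'))
        (M.stateLaw π h s n) :=
      Integrable.of_bound hm.aestronglyMeasurable b (.of_forall fun s' => by
        simpa using norm_integral_le_of_norm_le_const
          (μ := M.P (h + n) (s', π (h + n) s')) (f := u (h + n + 1))
          (.of_forall (hb (h + n + 1))))
    rw [Finset.sum_range_succ, ih (by omega), Finset.sum_range_succ]
    have h1 : ∫ s', M.td π u (h + n) s' ∂M.stateLaw π h s n =
        ∫ s', u (h + n) s' ∂M.stateLaw π h s n -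
          ∫ s', M.r (h + n) s' (π (h + n) s') ∂M.stateLaw π h s n -
          ∫ s', u (h + (n + 1)) s' ∂M.stateLaw π h s (n + 1) := by
      rw [M.integral_stateLaw_succ s hπn (hu _) (hb _), ← integral_sub hiu hir]
      exact integral_sub (f := fun s' => u (h + n) s' - M.r (h + n) s' (π (h + n) s'))
        (hiu.sub hir) hiP
    rw [h1]
    ring

/-- Expected values of `u` at successive states telescope, and the last one vanishes at step `H`.
This compares `Q⋆` with an arbitrary policy, and a function `f` with its own greedy policy. -/
theorem sub_V_eq_sum_td (hr : ∀ h < M.H, ∀ s a, M.r h s a ≤ 1)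
    (hπ : ∀ h < M.H, Measurable (π h)) (hu : ∀ h, Measurable (u h)) (hb : ∀ h s, |u h s| ≤ b)
    (huH : ∀ s, u M.H s = 0) {h : ℕ} (hh : h ≤ M.H) (s : S) :
    u h s - M.V π h s =
      ∑ i ∈ Finset.range (M.H - h), ∫ s', M.td π u (h + i) s' ∂M.stateLaw π h s i := by
  rw [sum_integral_td hr hπ hu hb h s (M.H - h) (by omega), Nat.add_sub_cancel' hh]
  simp [huH, V]

theorem V_nonneg (π : ℕ → S → A) (h : ℕ) (s : S) : 0 ≤ M.V π h s :=
  Finset.sum_nonneg fun _ _ => integral_nonneg fun _ => M.r_nonneg _ _ _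

end Telescoping

variable [MeasurableSingletonClass A] [Fintype A] [Nonempty A]

/-- The standing assumptions on the MDP and the two function classes. -/
structure Admissible (M : MDP S A) (F G : ℕ → Set (S → A → ℝ))
    (σ : ℕ → (S → A → ℝ) → S → A) : Prop where
  valF : M.IsValueClass F
  valG : M.IsValueClass G
  greedy : M.IsGreedy F σ
  real : M.Realizable F
  compl : M.GeneralizedComplete F G

/-- The optimal `Q`-functions, extended by `0` from step `H` on. -/
def qs (M : MDP S A) (h : ℕ) : S → A → ℝ := if h < M.H then M.Qstar h else 0

variable {F G : ℕ → Set (S → A → ℝ)} {σ : ℕ → (S → A → ℝ) → S → A}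

theorem IsValueClass.unitValued (hF : M.IsValueClass F) {f : ℕ → S → A → ℝ}
    (hf : f ∈ M.tuples F) (h : ℕ) : UnitValued (f h) := by
  by_cases hh : h < M.H
  · exact hF h hh _ (hf.1 h hh)
  · rw [hf.2 h (by omega)]; exact UnitValued.zero

/-- The Bellman residual of `f` at the greedy action. -/
def residual (M : MDP S A) (σ : ℕ → (S → A → ℝ) → S → A) (f : ℕ → S → A → ℝ) (h : ℕ) (s : S) : ℝ :=
  f h s (σ h (f h) s) - M.bellman h (f (h + 1)) s (σ h (f h) s)

namespace Admissible

theorem qs_mem (ha : M.Admissible F G σ) : M.qs ∈ M.tuples F :=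
  ⟨fun h hh => by rw [qs, if_pos hh]; exact ha.real h hh,
    fun h hh => by rw [qs, if_neg (by omega)]⟩

/-- The backup of `Q⋆` lies in `G`, hence is at most `1`, and its expectation part is nonnegative.
-/
theorem reward_le (ha : M.Admissible F G σ)
    {h : ℕ} (hh : h < M.H) (s : S) (a : A) : M.r h s a ≤ 1 := by
  have h1 := ((ha.valG h hh _ (ha.compl _ ha.qs_mem h hh)).2 s a).2
  rw [bellman_eq] at h1
  linarith [((ha.valF.unitValued ha.qs_mem (h + 1)).integral_mx_mem (M.P h (s, a))).1]

theorem mx_eq (ha : M.Admissible F G σ)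
    {f : ℕ → S → A → ℝ} (hf : f ∈ M.tuples F) {h : ℕ} (hh : h < M.H) (s : S) :
    mx (f h) s = f h s (greedyPolicy σ f h s) :=
  VGolf.mx_eq ((ha.greedy h hh _ (hf.1 h hh)).2 s)

theorem measurable_greedyPolicy (ha : M.Admissible F G σ)
    {f : ℕ → S → A → ℝ} (hf : f ∈ M.tuples F) {h : ℕ}
    (hh : h < M.H) : Measurable (greedyPolicy σ f h) :=
  (ha.greedy h hh _ (hf.1 h hh)).1

theorem mx_sub_V (ha : M.Admissible F G σ) {f : ℕ → S → A → ℝ} (hf : f ∈ M.tuples F) {π : ℕ → S → A}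
    (hπ : ∀ h < M.H, Measurable (π h)) {h : ℕ} (hh : h ≤ M.H) (s : S) :
    mx (f h) s - M.V π h s = ∑ i ∈ Finset.range (M.H - h),
      ∫ s', M.td π (fun h => mx (f h)) (h + i) s' ∂M.stateLaw π h s i :=
  sub_V_eq_sum_td (u := fun h => mx (f h)) (b := 1) (fun _ hh => ha.reward_le hh) hπ
    (fun h => (ha.valF.unitValued hf h).measurable_mx)
    (fun h s => by
      have := (ha.valF.unitValued hf h).mx_mem s
      exact abs_le.2 ⟨by linarith [this.1], this.2⟩)
    (fun s => by simp [mx, hf.2 M.H le_rfl]) hh s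

theorem td_greedy (ha : M.Admissible F G σ)
    {f : ℕ → S → A → ℝ} (hf : f ∈ M.tuples F) {h : ℕ} (hh : h < M.H) (s : S) :
    M.td (greedyPolicy σ f) (fun h => mx (f h)) h s = M.residual σ f h s := by
  rw [td, ha.mx_eq hf hh, residual, bellman_eq, sub_sub]
  rfl

/-- Along the greedy policy of `f`, the temporal differences of `max_a f` are exactly the residuals
at the greedy action. An overestimate of the value is therefore paid for by residuals under the
policy actually played. -/
theorem mx_sub_V_greedy (ha : M.Admissible F G σ) {f : ℕ → S → A → ℝ} (hf : f ∈ M.tuples F) :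
    mx (f 0) M.s₁ - M.V (greedyPolicy σ f) 0 M.s₁ = ∑ h : Fin M.H,
      ∫ s, M.residual σ f h s ∂M.stateLaw (greedyPolicy σ f) 0 M.s₁ h := by
  rw [ha.mx_sub_V hf (fun h hh => ha.measurable_greedyPolicy hf hh) (Nat.zero_le _), Nat.sub_zero,
    ← Fin.sum_univ_eq_sum_range (fun i => ∫ s', M.td (greedyPolicy σ f) (fun h => mx (f h))
      (0 + i) s' ∂M.stateLaw (greedyPolicy σ f) 0 M.s₁ i)]
  refine Finset.sum_congr rfl fun h _ => integral_congr_ae (.of_forall fun s => ?_)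
  simpa using ha.td_greedy hf h.2 s

/-- Bellman's optimality equation. -/
theorem qstar_eq (ha : M.Admissible F G σ)
    : ∀ n h, h < M.H → M.H - h ≤ n → M.Qstar h = M.bellman h (M.qs (h + 1)) := by
  intro n
  induction n with
  | zero => intro h hh hn; omega
  | succ n ih =>
    intro h hh hn
    have hq := ha.qs_mem
    -- The induction runs backwards in `h`, so the optimality equation is available at all steps
    -- after `h`. It makes the temporal differences of `max_a Q⋆` nonnegative under every policy.
    have hle : ∀ π : M.Policy, ∀ s, M.V π.1 (h + 1) s ≤ mx (M.qs (h + 1)) s := fun π s => by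
      refine sub_nonneg.1 ?_
      rw [ha.mx_sub_V hq π.2 hh]
      refine Finset.sum_nonneg fun i hi => integral_nonneg fun s' => ?_
      have hi' : h + 1 + i < M.H := by have := Finset.mem_range.1 hi; omega
      have h1 := le_mx (M.qs (h + 1 + i)) s' (π.1 (h + 1 + i) s')
      have h2 : M.qs (h + 1 + i) = M.bellman (h + 1 + i) (M.qs (h + 1 + i + 1)) := by
        rw [← ih _ hi' (by omega), qs, if_pos hi']
      have h3 := congrFun (congrFun h2 s') (π.1 (h + 1 + i) s')
      rw [bellman_eq] at h3
      simp only [td, Pi.zero_apply]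
      linarith
    -- The greedy policy of `Q⋆` has zero temporal differences, so a single policy attains the
    -- supremum at all states simultaneously. Realizability makes it measurable.
    let π₀ : M.Policy := ⟨greedyPolicy σ M.qs, fun h hh => ha.measurable_greedyPolicy hq hh⟩
    have heq : ∀ s, M.V π₀.1 (h + 1) s = mx (M.qs (h + 1)) s := fun s => by
      refine (sub_eq_zero.1 ?_).symm
      rw [ha.mx_sub_V hq π₀.2 hh]
      refine Finset.sum_eq_zero fun i hi => ?_
      have hi' : h + 1 + i < M.H := by have := Finset.mem_range.1 hi; omega
      have h2 : M.qs (h + 1 + i) = M.bellman (h + 1 + i) (M.qs (h + 1 + i + 1)) := by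
        rw [← ih _ hi' (by omega), qs, if_pos hi']
      refine integral_eq_zero_of_ae (.of_forall fun s' => ?_)
      refine (ha.td_greedy hq hi' s').trans ?_
      rw [residual, ← h2, sub_self]
      rfl
    have hu := ha.valF.unitValued hq (h + 1)
    funext s a
    have hQ : ∀ π : M.Policy, M.Q π.1 h s a ≤ M.bellman h (M.qs (h + 1)) s a := fun π => by
      rw [bellman_eq, Q]
      refine add_le_add le_rfl ?_
      exact integral_mono_of_nonneg (.of_forall fun s' => V_nonneg _ _ _) (hu.integrable_mx _)
        (.of_forall (hle π))
    have : Nonempty M.Policy := ⟨π₀⟩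
    refine le_antisymm (ciSup_le hQ) ?_
    refine le_trans (le_of_eq ?_) (le_ciSup (f := fun π : M.Policy => M.Q π.1 h s a)
      ⟨_, Set.forall_mem_range.2 hQ⟩ π₀)
    simp only [bellman_eq, Q, heq]

theorem bellman_qs (ha : M.Admissible F G σ)
    {h : ℕ} (hh : h < M.H) : M.bellman h (M.qs (h + 1)) = M.qs h := by
  rw [← ha.qstar_eq (M.H - h) h hh le_rfl, qs, if_pos hh]

theorem Vstar_le (ha : M.Admissible F G σ) : M.Vstar 0 M.s₁ ≤ mx (M.qs 0) M.s₁ := by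
  have hq := ha.qs_mem
  have : Nonempty M.Policy :=
    ⟨⟨greedyPolicy σ M.qs, fun h hh => ha.measurable_greedyPolicy hq hh⟩⟩
  refine ciSup_le fun π => sub_nonneg.1 ?_
  rw [ha.mx_sub_V hq π.2 (Nat.zero_le _)]
  refine Finset.sum_nonneg fun i hi => integral_nonneg fun s' => ?_
  have hi' : 0 + i < M.H := by have := Finset.mem_range.1 hi; omega
  have h1 := le_mx (M.qs (0 + i)) s' (π.1 (0 + i) s')
  have h3 := congrFun (congrFun (ha.bellman_qs hi') s') (π.1 (0 + i) s')
  rw [bellman_eq] at h3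
  simp only [td, Pi.zero_apply]
  linarith

theorem Vstar_le_one (ha : M.Admissible F G σ) : M.Vstar 0 M.s₁ ≤ 1 :=
  ha.Vstar_le.trans ((ha.valF.unitValued ha.qs_mem 0).mx_mem M.s₁).2

theorem isOptimalUpTo_of_one_le (ha : M.Admissible F G σ)
    {η : ℝ} (hη : 1 ≤ η) (π : ℕ → S → A) : M.IsOptimalUpTo η π := by
  have h1 := ha.Vstar_le_one
  have h2 := V_nonneg (M := M) π 0 M.s₁
  rw [IsOptimalUpTo]
  linarith

end Admissible

end MDP

end

theorem abs_sq_sub_sq_le {x y δ : ℝ} (h : |x - y| ≤ δ) (hx : |x| ≤ 2) (hy : |y| ≤ 2) :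
    |x ^ 2 - y ^ 2| ≤ 4 * δ := by
  rw [sq_sub_sq, abs_mul, mul_comm (4 : ℝ), mul_comm]
  exact mul_le_mul h (by linarith [abs_add_le x y]) (abs_nonneg _) ((abs_nonneg _).trans h)

theorem sq_integral_le {X : Type*} [MeasurableSpace X] {μ : Measure X} [IsProbabilityMeasure μ]
    {f : X → ℝ} (hf : Integrable f μ) (hf2 : Integrable (fun x => f x ^ 2) μ) :
    (∫ x, f x ∂μ) ^ 2 ≤ ∫ x, f x ^ 2 ∂μ := by
  set c := ∫ x, f x ∂μ with hc
  have h0 : 0 ≤ ∫ x, (f x - c) ^ 2 ∂μ := integral_nonneg fun _ => sq_nonneg _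
  have h1 : ∫ x, (f x - c) ^ 2 ∂μ = ∫ x, (f x ^ 2 - 2 * c * f x + c ^ 2) ∂μ :=
    integral_congr_ae (.of_forall fun x => by simp only; ring)
  have h2 : Integrable (fun x => f x ^ 2 - 2 * c * f x) μ := hf2.sub (hf.const_mul _)
  rw [h1, integral_add h2 (integrable_const _), integral_sub hf2 (hf.const_mul _),
    integral_const_mul, ← hc] at h0
  simp only [integral_const, probReal_univ, one_smul] at h0
  nlinarith

noncomputable section

namespace MDP

variable {S A : Type*} [MeasurableSpace S] [MeasurableSpace A] {M : MDP S A}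
  [MeasurableSingletonClass A] [Fintype A] [Nonempty A]

/-! ### Replacing a function by a nearby cover centre -/

section Perturbation

variable {h : ℕ} {ξ ζ ξ' ζ' : S → A → ℝ} {ρ : ℝ}

/-- In each of the two squares the base has modulus at most `2` and moves by at most `2 ρ`, so each
square moves by at most `8 ρ`. -/
theorem abs_excess_sub_le (hr : ∀ s a, M.r h s a ≤ 1) (hξ : UnitValued ξ) (hζ : UnitValued ζ)
    (hξ' : UnitValued ξ') (hζ' : UnitValued ζ') (h1 : ∀ s a, |ξ s a - ξ' s a| ≤ ρ)
    (h2 : ∀ s a, |ζ s a - ζ' s a| ≤ ρ) {z : S × A × ℝ × S} (hz : z.2.2.1 ∈ Set.Icc (0 : ℝ) 1) :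
    |M.excess h ξ ζ z - M.excess h ξ' ζ' z| ≤ 16 * ρ := by
  obtain ⟨s, a, r, s'⟩ := z
  simp only at hz
  have a1 := hξ.2 s a
  have a2 := hξ'.2 s a
  have a3 := hζ.mx_mem s'
  have a4 := hζ'.mx_mem s'
  have a5 := bellman_mem hr hζ s a
  have a6 := bellman_mem hr hζ' s a
  have b1 := abs_le.1 (h1 s a)
  have b2 := abs_le.1 (mx_sub_le (s := s') (h2 s'))
  have b3 := abs_le.1 (M.bellman_sub_le hζ hζ' h h2 s a)
  simp only [Set.mem_Icc] at *
  have c1 := abs_le.1 (abs_sq_sub_sq_le (x := ξ s a - r - mx ζ s') (y := ξ' s a - r - mx ζ' s')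
    (δ := 2 * ρ) (abs_le.2 ⟨by linarith, by linarith⟩) (abs_le.2 ⟨by linarith, by linarith⟩)
    (abs_le.2 ⟨by linarith, by linarith⟩))
  have c2 := abs_le.1 (abs_sq_sub_sq_le (x := M.bellman h ζ s a - r - mx ζ s')
    (y := M.bellman h ζ' s a - r - mx ζ' s')
    (δ := 2 * ρ) (abs_le.2 ⟨by linarith, by linarith⟩) (abs_le.2 ⟨by linarith, by linarith⟩)
    (abs_le.2 ⟨by linarith, by linarith⟩))
  simp only [excess]
  exact abs_le.2 ⟨by linarith, by linarith⟩

theorem meanSq_le_add (hr : ∀ s a, M.r h s a ≤ 1) (hξ : UnitValued ξ) (hζ : UnitValued ζ)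
    (hξ' : UnitValued ξ') (hζ' : UnitValued ζ') (h1 : ∀ s a, |ξ s a - ξ' s a| ≤ ρ)
    (h2 : ∀ s a, |ζ s a - ζ' s a| ≤ ρ) (s : S) :
    M.meanSq h ξ ζ s ≤ M.meanSq h ξ' ζ' s + 8 * ρ := by
  have hc : (0 : ℝ) < Fintype.card A := by exact_mod_cast Fintype.card_pos
  have h3 : ∀ a, (ξ s a - M.bellman h ζ s a) ^ 2 ≤ (ξ' s a - M.bellman h ζ' s a) ^ 2 + 8 * ρ := by
    intro a
    have a1 := hξ.2 s a
    have a2 := hξ'.2 s a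
    have a5 := bellman_mem hr hζ s a
    have a6 := bellman_mem hr hζ' s a
    have b1 := abs_le.1 (h1 s a)
    have b3 := abs_le.1 (M.bellman_sub_le hζ hζ' h h2 s a)
    simp only [Set.mem_Icc] at *
    have c1 := abs_le.1 (abs_sq_sub_sq_le (x := ξ s a - M.bellman h ζ s a)
      (y := ξ' s a - M.bellman h ζ' s a) (δ := 2 * ρ) (abs_le.2 ⟨by linarith, by linarith⟩)
      (abs_le.2 ⟨by linarith, by linarith⟩) (abs_le.2 ⟨by linarith, by linarith⟩))
    linarith
  rw [meanSq, meanSq, inv_mul_le_iff₀ hc, mul_add, mul_inv_cancel_left₀ hc.ne']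
  refine (Finset.sum_le_sum fun a _ => h3 a).trans (le_of_eq ?_)
  rw [Finset.sum_add_distrib]
  simp

theorem sum_excess_eq {k : ℕ} (D : Fin k → M.Epoch) (h : Fin M.H) (ξ ζ : S → A → ℝ) :
    ∑ i, M.excess h ξ ζ (D i h) = M.loss D h ξ ζ - M.loss D h (M.bellman h ζ) ζ := by
  rw [loss, loss, ← Finset.sum_sub_distrib]
  rfl

end Perturbation

section Residual

variable {F G : ℕ → Set (S → A → ℝ)} {σ : ℕ → (S → A → ℝ) → S → A}

theorem Admissible.abs_residual_le_one (ha : M.Admissible F G σ) {f : ℕ → S → A → ℝ}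
    (hf : f ∈ M.tuples F) {h : ℕ} (hh : h < M.H) (s : S) : |M.residual σ f h s| ≤ 1 := by
  have h1 := (ha.valF.unitValued hf h).2 s (σ h (f h) s)
  have h2 := (ha.valG h hh _ (ha.compl f hf h hh)).2 s (σ h (f h) s)
  exact abs_le.2 ⟨by rw [residual]; linarith [h1.1, h2.2], by rw [residual]; linarith [h1.2, h2.1]⟩

theorem Admissible.measurable_residual (ha : M.Admissible F G σ) {f : ℕ → S → A → ℝ}
    (hf : f ∈ M.tuples F) {h : ℕ} (hh : h < M.H) : Measurable (M.residual σ f h) := by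
  have h1 : Measurable fun s => (s, σ h (f h) s) :=
    measurable_id.prodMk (ha.measurable_greedyPolicy hf hh)
  exact ((ha.valF.unitValued hf h).1.comp h1).sub
    ((M.measurable_bellman (ha.valF.unitValued hf (h + 1)) h).comp h1)

/-- The greedy action contributes one of the terms averaged in `meanSq`; this is where the factor
`|A|` enters. -/
theorem residual_sq_le (f : ℕ → S → A → ℝ) (h : ℕ) (s : S) :
    M.residual σ f h s ^ 2 ≤ Fintype.card A * M.meanSq h (f h) (f (h + 1)) s := by
  have hc : (Fintype.card A : ℝ) ≠ 0 := by exact_mod_cast Fintype.card_ne_zero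
  rw [meanSq, mul_inv_cancel_left₀ hc, residual]
  exact Finset.single_le_sum
    (f := fun a => (f h s a - M.bellman h (f (h + 1)) s a) ^ 2) (fun _ _ => sq_nonneg _)
    (Finset.mem_univ _)

theorem Admissible.sq_integral_residual_le (ha : M.Admissible F G σ) {f : ℕ → S → A → ℝ}
    (hf : f ∈ M.tuples F) {h : ℕ} (hh : h < M.H) (μ : Measure S) [IsProbabilityMeasure μ] :
    (∫ s, M.residual σ f h s ∂μ) ^ 2 ≤
      Fintype.card A * ∫ s, M.meanSq h (f h) (f (h + 1)) s ∂μ := by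
  have hm := ha.measurable_residual hf hh
  have hb := ha.abs_residual_le_one hf hh
  have hi : Integrable (M.residual σ f h) μ :=
    Integrable.of_bound hm.aestronglyMeasurable 1 (.of_forall hb)
  have hi2 : Integrable (fun s => M.residual σ f h s ^ 2) μ :=
    Integrable.of_bound (hm.pow_const 2).aestronglyMeasurable 1 (.of_forall fun s => by
      rw [Real.norm_eq_abs, abs_pow]
      exact pow_le_one₀ (abs_nonneg _) (hb s))
  refine (sq_integral_le hi hi2).trans ?_
  rw [← integral_const_mul]
  exact integral_mono hi2 ((integrable_meanSq (fun s a => ha.reward_le hh s a)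
    (ha.valF.unitValued hf h) (ha.valF.unitValued hf (h + 1)) μ).const_mul _)
    fun s => residual_sq_le f h s

end Residual

/-! ### Confidence sets when no deviation over the cover is large -/

section Confidence

/-- Accumulated mean squared residual (rescaled) minus accumulated excess loss (rescaled). -/
def deviation (M : MDP S A) {k : ℕ} (ν : Fin k → Measure S) (h : Fin M.H) (ξ ζ : S → A → ℝ)
    (D : Fin k → M.Epoch) : ℝ :=
  ∑ i, ((∫ s, M.meanSq h ξ ζ s ∂ν i) / 32 - M.excess h ξ ζ (D i h) / 8)

variable {F G : ℕ → Set (S → A → ℝ)} {σ : ℕ → (S → A → ℝ) → S → A} {k : ℕ}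
  {D : Fin k → M.Epoch} {h : Fin M.H} {ν : Fin k → Measure S} {ρ θ β : ℝ}
  {ξ ζ ξ' ζ' : S → A → ℝ}

theorem deviation_eq : M.deviation ν h ξ ζ D =
    (∑ i, ∫ s, M.meanSq h ξ ζ s ∂ν i) / 32 - (∑ i, M.excess h ξ ζ (D i h)) / 8 := by
  rw [deviation, Finset.sum_sub_distrib, Finset.sum_div, Finset.sum_div]

theorem abs_sum_excess_sub_le (hr : ∀ s a, M.r h s a ≤ 1)
    (hD : ∀ i, (D i h).2.2.1 ∈ Set.Icc (0 : ℝ) 1) (hξ : UnitValued ξ) (hζ : UnitValued ζ)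
    (hξ' : UnitValued ξ') (hζ' : UnitValued ζ') (h1 : ∀ s a, |ξ s a - ξ' s a| ≤ ρ)
    (h2 : ∀ s a, |ζ s a - ζ' s a| ≤ ρ) :
    |∑ i, M.excess h ξ ζ (D i h) - ∑ i, M.excess h ξ' ζ' (D i h)| ≤ 16 * (k * ρ) := by
  rw [← Finset.sum_sub_distrib]
  refine (Finset.abs_sum_le_sum_abs _ _).trans ((Finset.sum_le_sum fun i _ =>
    abs_excess_sub_le hr hξ hζ hξ' hζ' h1 h2 (hD i)).trans (le_of_eq ?_))
  simp
  ring

namespace Admissible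

/-- The cover consists of whole tuples, whereas the infimum in the confidence set concerns one
coordinate. The remaining coordinates are filled with backups of `Q⋆`, which lie in `G`. -/
theorem exists_tuple_eq (ha : M.Admissible F G σ)
    {g : S → A → ℝ} {h : ℕ} (hh : h < M.H) (hg : g ∈ G h) :
    ∃ g' ∈ M.tuples G, g' h = g := by
  classical
  refine ⟨fun m => if m < M.H then (if m = h then g else M.bellman m (M.qs (m + 1))) else 0,
    ⟨fun m hm => ?_, fun m hm => if_neg (by omega)⟩, by simp [hh]⟩
  simp only [if_pos hm]
  split_ifs with he
  · rwa [he]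
  · exact ha.compl _ ha.qs_mem m hm

/-- If no deviation over the cover is large, the optimal `Q`-functions are in the confidence set. -/
theorem qs_mem_confidenceSet (ha : M.Admissible F G σ)
    {W : Set (ℕ → S → A → ℝ)} (hW : W ⊆ M.tuples F ∪ M.tuples G)
    (hcov : ∀ f ∈ M.tuples F ∪ M.tuples G, ∃ w ∈ W, ∀ h s a, |f h s a - w h s a| ≤ ρ)
    (hD : ∀ i h, (D i h).2.2.1 ∈ Set.Icc (0 : ℝ) 1) (hρ : 0 ≤ ρ)
    {ν : Fin M.H → Fin k → Measure S}
    (hdev : ∀ h : Fin M.H, ∀ w ∈ W, M.deviation (ν h) h (w h) (M.qs (h + 1)) D ≤ θ)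
    (hβ : 8 * θ + 16 * (k * ρ) ≤ β) : M.qs ∈ M.confidenceSet F G β D := by
  refine ⟨ha.qs_mem, fun h => ?_⟩
  have hne : Nonempty (G h) := ⟨⟨_, ha.compl _ ha.qs_mem h h.2⟩⟩
  rw [← sub_le_iff_le_add]
  refine le_ciInf fun g => ?_
  obtain ⟨g', hg', hgg⟩ := ha.exists_tuple_eq h.2 g.2
  obtain ⟨w, hw, hclose⟩ := hcov g' (Or.inr hg')
  have hq := ha.valF.unitValued ha.qs_mem (h + 1)
  have hg1 : UnitValued g.1 := ha.valG h h.2 _ g.2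
  have hw1 : UnitValued (w h) := (hW hw).elim (fun H => ha.valF.unitValued H h)
    fun H => ha.valG.unitValued H h
  -- Only the first argument moves to the cover. The target function stays equal to `Q⋆`, so that
  -- its backup is exactly `Q⋆` at step `h` and the excess is the loss of `g` minus that of `Q⋆`.
  have h1 := abs_le.1 (abs_sum_excess_sub_le (h := h) (fun s a => ha.reward_le h.2 s a)
    (fun i => hD i h) hg1 hq hw1 hq (by rw [← hgg]; exact hclose h) (ζ := M.qs (h + 1))
    (fun s a => by simpa using hρ))
  have h2 := hdev h w hw
  have h3 := sum_excess_eq D h g.1 (M.qs (h + 1))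
  have h4 : 0 ≤ ∑ i, ∫ s, M.meanSq h (w h) (M.qs (h + 1)) s ∂ν h i :=
    Finset.sum_nonneg fun i _ => integral_nonneg fun s =>
      (meanSq_mem (fun s a => ha.reward_le h.2 s a) hw1 hq s).1
  rw [deviation_eq] at h2
  rw [ha.bellman_qs h.2] at h3
  linarith

/-- If no deviation over the cover is large, members of the confidence set have small residuals. -/
theorem sum_sq_residual_le (ha : M.Admissible F G σ)
    {W : Set (ℕ → S → A → ℝ)} (hW : W ⊆ M.tuples F ∪ M.tuples G)
    (hcov : ∀ f ∈ M.tuples F ∪ M.tuples G, ∃ w ∈ W, ∀ h s a, |f h s a - w h s a| ≤ ρ)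
    (hD : ∀ i h, (D i h).2.2.1 ∈ Set.Icc (0 : ℝ) 1) [∀ i, IsProbabilityMeasure (ν i)]
    (hdev : ∀ w ∈ W, M.deviation ν h (w h) (w (h + 1)) D ≤ θ)
    {f : ℕ → S → A → ℝ} (hf : f ∈ M.confidenceSet F G β D) :
    ∑ i, (∫ s, M.residual σ f h s ∂ν i) ^ 2 ≤
      Fintype.card A * (32 * θ + 4 * β + 72 * (k * ρ)) := by
  obtain ⟨hfF, hfc⟩ := hf
  obtain ⟨w, hw, hclose⟩ := hcov f (Or.inl hfF)
  have hr : ∀ s a, M.r h s a ≤ 1 := fun s a => ha.reward_le h.2 s a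
  have hf1 := ha.valF.unitValued hfF
  have hw1 : ∀ h, UnitValued (w h) := fun h => (hW hw).elim (fun H => ha.valF.unitValued H h)
    fun H => ha.valG.unitValued H h
  have h1 := abs_le.1 (abs_sum_excess_sub_le (h := h) hr (fun i => hD i h) (hf1 h) (hf1 (h + 1))
    (hw1 h) (hw1 (h + 1)) (hclose h) (hclose (h + 1)))
  have h2 := hdev w hw
  rw [deviation_eq] at h2
  have h3 := sum_excess_eq D h (f h) (f (h + 1))
  have h4 := hfc h
  -- By completeness the backup of `f` competes in the infimum, so the excess loss of `f` is at most
  -- `β`.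
  have h5 : (⨅ g : G h, M.loss D h g.1 (f (h + 1))) ≤
      M.loss D h (M.bellman h (f (h + 1))) (f (h + 1)) :=
    ciInf_le (f := fun g : G h => M.loss D h g.1 (f (h + 1)))
      ⟨0, Set.forall_mem_range.2 fun g => Finset.sum_nonneg fun _ _ => sq_nonneg _⟩
      ⟨_, ha.compl f hfF h h.2⟩
  have h6 : ∑ i, ∫ s, M.meanSq h (f h) (f (h + 1)) s ∂ν i ≤
      ∑ i, ∫ s, M.meanSq h (w h) (w (h + 1)) s ∂ν i + 8 * (k * ρ) := by
    have h7 : ∀ i, ∫ s, M.meanSq h (f h) (f (h + 1)) s ∂ν i ≤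
        ∫ s, M.meanSq h (w h) (w (h + 1)) s ∂ν i + 8 * ρ := fun i => by
      have i1 := integrable_meanSq hr (hf1 h) (hf1 (h + 1)) (ν i)
      have i2 := integrable_meanSq hr (hw1 h) (hw1 (h + 1)) (ν i)
      have := integral_mono i1 (i2.add (integrable_const (8 * ρ))) fun s =>
        meanSq_le_add hr (hf1 h) (hf1 (h + 1)) (hw1 h) (hw1 (h + 1)) (hclose h)
          (hclose (h + 1)) s
      simpa [integral_add i2 (integrable_const (8 * ρ))] using this
    refine (Finset.sum_le_sum fun i _ => h7 i).trans (le_of_eq ?_)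
    rw [Finset.sum_add_distrib]
    simp
    ring
  calc ∑ i, (∫ s, M.residual σ f h s ∂ν i) ^ 2
      ≤ ∑ i, Fintype.card A * ∫ s, M.meanSq h (f h) (f (h + 1)) s ∂ν i :=
        Finset.sum_le_sum fun i _ => ha.sq_integral_residual_le hfF h.2 (ν i)
    _ = Fintype.card A * ∑ i, ∫ s, M.meanSq h (f h) (f (h + 1)) s ∂ν i := by
        rw [Finset.mul_sum]
    _ ≤ _ := by
        refine mul_le_mul_of_nonneg_left ?_ (Nat.cast_nonneg _)
        -- The centre `w` has excess at most `β + 16 k ρ`, hence total mean square at most `32 θ + 4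
        -- β + 64 k ρ`; returning from `w` to `f` adds `8 k ρ`.
        linarith

end Admissible

end Confidence

end MDP

end

/-! ### Concentration along a run of the algorithm -/

noncomputable section

namespace MDP

variable {S A : Type*} [MeasurableSpace S] [MeasurableSpace A] {M : MDP S A}
  [MeasurableSingletonClass A] [Fintype A] [Nonempty A]
  {F G : ℕ → Set (S → A → ℝ)} {σ : ℕ → (S → A → ℝ) → S → A} {K : ℕ} {β : ℝ}
  {sel : (k : ℕ) → (Fin k → M.Epoch) → ℕ → S → A → ℝ}

/-- Law of the data of the next epoch. -/
def sampling (M : MDP S A) (σ : ℕ → (S → A → ℝ) → S → A)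
    (sel : (k : ℕ) → (Fin k → M.Epoch) → ℕ → S → A → ℝ) (k : ℕ) (D : Fin k → M.Epoch) :
    Measure M.Epoch :=
  M.epochLaw (greedyPolicy σ (sel k D))

theorem dataLaw_eq (k : ℕ) : M.dataLaw σ sel k = adaptiveLaw (M.sampling σ sel) k := by
  induction k with
  | zero => rfl
  | succ k ih => rw [dataLaw, adaptiveLaw, ih]; rfl

/-- The law against which the residuals are tested at step `h` after epoch `i`. -/
def testLaw (M : MDP S A) (b : Bool) (σ : ℕ → (S → A → ℝ) → S → A)
    (sel : (k : ℕ) → (Fin k → M.Epoch) → ℕ → S → A → ℝ) {k : ℕ} (D : Fin k → M.Epoch)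
    (h : Fin M.H) (i : Fin k) : Measure S :=
  M.evalLaw b (M.policyAt σ sel D i) h (D i h).1

theorem policyAt_eq (D : Fin K → M.Epoch) (k : Fin K) :
    M.policyAt σ sel D k = greedyPolicy σ (sel k (pre D k k.2.le)) := rfl

/-- No deviation over the cover `W` exceeds `θ`. -/
def NoDeviation (M : MDP S A) (b : Bool) (σ : ℕ → (S → A → ℝ) → S → A)
    (sel : (k : ℕ) → (Fin k → M.Epoch) → ℕ → S → A → ℝ) (W : Finset (ℕ → S → A → ℝ)) (θ : ℝ)
    (D : Fin K → M.Epoch) : Prop :=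
  ∀ (k : Fin K) (h : Fin M.H), ∀ w ∈ W, ∀ o : Bool,
    M.deviation (M.testLaw b σ sel (pre D k k.2.le) h) h (w h)
      (if o then M.qs (h + 1) else w (h + 1)) (pre D k k.2.le) < θ

/-- The residuals of the function chosen after the data `D` are small at step `h` on the past. -/
def SmallPast (M : MDP S A) (b : Bool) (σ : ℕ → (S → A → ℝ) → S → A)
    (sel : (k : ℕ) → (Fin k → M.Epoch) → ℕ → S → A → ℝ) (Γ : ℝ) {k : ℕ} (h : Fin M.H)
    (D : Fin k → M.Epoch) : Prop :=
  ∑ i, (∫ s, M.residual σ (sel k D) h s ∂M.testLaw b σ sel D h i) ^ 2 ≤ Γ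

namespace IsVGolf

section Measurability

theorem measurable_policyAt (hsel : M.IsVGolf F G σ K β sel)
    (ha : M.Admissible F G σ) {k : ℕ} (hk : k ≤ K)
    (D : Fin k → M.Epoch) (i : Fin k) {h : ℕ} (hh : h < M.H) :
    Measurable (M.policyAt σ sel D i h) :=
  ha.measurable_greedyPolicy (hsel.mem i (i.2.trans_le hk) _) hh

theorem isProbabilityMeasure_testLaw (hsel : M.IsVGolf F G σ K β sel)
    (ha : M.Admissible F G σ) (b : Bool) {k : ℕ} (hk : k ≤ K)
    (D : Fin k → M.Epoch) (h : Fin M.H) (i : Fin k) :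
    IsProbabilityMeasure (M.testLaw b σ sel D h i) :=
  isProbabilityMeasure_evalLaw b
    (fun _ hm => hsel.measurable_policyAt ha hk D i (hm.trans h.2)) _

theorem isSampling (hsel : M.IsVGolf F G σ K β sel)
    (ha : M.Admissible F G σ) : IsSampling (M.sampling σ sel) K where
  meas k hk := M.measurable_epochLaw (π := fun D => greedyPolicy σ (sel k D))
    (hsel.measurable_policy k hk)
  prob k hk D := M.isProbabilityMeasure_epochLaw fun _ hm =>
    ha.measurable_greedyPolicy (hsel.mem k hk D) hm

theorem measurable_evalLaw_next (hsel : M.IsVGolf F G σ K β sel)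
    (b : Bool) {k : ℕ} (hk : k < K) (h : Fin M.H) :
    Measurable fun p : (Fin k → M.Epoch) × M.Epoch =>
      M.evalLaw b (greedyPolicy σ (sel k p.1)) h (p.2 h).1 :=
  measurable_evalLaw (π := fun p : (Fin k → M.Epoch) × M.Epoch => greedyPolicy σ (sel k p.1)) b
    (fun m hm => (hsel.measurable_policy k hk m (hm.trans h.2)).comp
      (measurable_fst.fst.prodMk measurable_snd))
    ((measurable_pi_apply h).comp measurable_snd).fst

theorem isProbabilityMeasure_evalLaw_next (hsel : M.IsVGolf F G σ K β sel)
    (ha : M.Admissible F G σ) (b : Bool) {k : ℕ}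
    (hk : k < K) (h : Fin M.H) (D : Fin k → M.Epoch) (s : S) :
    IsProbabilityMeasure (M.evalLaw b (greedyPolicy σ (sel k D)) h s) :=
  isProbabilityMeasure_evalLaw b (fun _ hm =>
    ha.measurable_greedyPolicy (hsel.mem k hk D) (hm.trans h.2)) s

theorem measurable_testLaw (hsel : M.IsVGolf F G σ K β sel)
    (b : Bool) {k : ℕ} (hk : k ≤ K) (h : Fin M.H) (i : Fin k) :
    Measurable fun D : Fin k → M.Epoch => M.testLaw b σ sel D h i := by
  have h1 : Measurable fun D : Fin k → M.Epoch => pre D i i.2.le := measurable_pre i.2.le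
  have h2 : Measurable fun D : Fin k → M.Epoch => D i := measurable_pi_apply i
  have h3 := (hsel.measurable_evalLaw_next b (i.2.trans_le hk) h).comp (h1.prodMk h2)
  simp only [testLaw, policyAt_eq]
  exact h3

theorem measurable_residual_param (hsel : M.IsVGolf F G σ K β sel)
    {k : ℕ} (hk : k < K) {h : ℕ} (hh : h < M.H) :
    Measurable fun p : (Fin k → M.Epoch) × S => M.residual σ (sel k p.1) h p.2 := by
  have hv : ∀ h, Measurable fun p : (Fin k → M.Epoch) × S × A => sel k p.1 h p.2.1 p.2.2 := by
    intro h
    by_cases hh : h < M.H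
    · exact hsel.measurable_value k hk h hh
    · have : ∀ D, sel k D h = 0 := fun D => (hsel.mem k hk D).2 h (by omega)
      simp only [this, Pi.zero_apply]
      exact measurable_const
  have hg : Measurable fun p : (Fin k → M.Epoch) × S => (p.1, p.2, σ h (sel k p.1 h) p.2) :=
    measurable_fst.prodMk (measurable_snd.prodMk (hsel.measurable_policy k hk h hh))
  exact ((hv h).comp hg).sub ((M.measurable_bellman_param
    (g := fun D : Fin k → M.Epoch => sel k D (h + 1)) (hv (h + 1)) h).comp hg)

end Measurability

section GoodEvent

variable {θ ρ : ℝ}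

theorem measure_deviation_ge_le (hsel : M.IsVGolf F G σ K β sel)
    (ha : M.Admissible F G σ) (b : Bool) {k : ℕ} (hk : k ≤ K)
    (h : Fin M.H) {ξ ζ : S → A → ℝ} (hξ : UnitValued ξ) (hζ : UnitValued ζ) :
    M.dataLaw σ sel K {D | θ ≤ M.deviation (M.testLaw b σ sel (pre D k hk) h) h ξ ζ (pre D k hk)} ≤
      ENNReal.ofReal (Real.exp (-θ)) := by
  rw [dataLaw_eq]
  have hm : ∀ k < K, Measurable fun p : (Fin k → M.Epoch) × M.Epoch =>
      ∫ s, M.meanSq h ξ ζ s ∂M.evalLaw b (greedyPolicy σ (sel k p.1)) h (p.2 h).1 := fun k hk =>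
    measurable_integral_param
      (κ := fun p : (Fin k → M.Epoch) × M.Epoch =>
        M.evalLaw b (greedyPolicy σ (sel k p.1)) h (p.2 h).1)
      (g := fun _ s => M.meanSq h ξ ζ s) (hsel.measurable_evalLaw_next b hk h)
      (fun p => hsel.isProbabilityMeasure_evalLaw_next ha b hk h p.1 _)
      ((measurable_meanSq hξ hζ).comp measurable_snd)
  refine (hsel.isSampling ha).measure_sum_gt_le
    (w := fun k D e => (∫ s, M.meanSq h ξ ζ s ∂M.evalLaw b (greedyPolicy σ (sel k D)) h (e h).1) /
      32 - M.excess h ξ ζ (e h) / 8)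
    (fun k hk => ((hm k hk).div_const 32).sub (((measurable_excess hξ hζ).comp
      ((measurable_pi_apply h).comp measurable_snd)).div_const 8))
    (fun k hk D => ?_) θ hk
  have hπ : ∀ m < M.H, Measurable (greedyPolicy σ (sel k D) m) := fun m hm =>
    ha.measurable_greedyPolicy (hsel.mem k hk D) hm
  have hc : Measurable fun s => ∫ s', M.meanSq h ξ ζ s'
      ∂M.evalLaw b (greedyPolicy σ (sel k D)) h s :=
    measurable_integral_param (κ := fun s => M.evalLaw b (greedyPolicy σ (sel k D)) h s)
      (g := fun _ s' => M.meanSq h ξ ζ s')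
      (measurable_evalLaw b (π := fun _ => greedyPolicy σ (sel k D))
        (fun m hm => (hπ m (hm.trans h.2)).comp measurable_snd) measurable_id)
      (hsel.isProbabilityMeasure_evalLaw_next ha b hk h D)
      ((measurable_meanSq hξ hζ).comp measurable_snd)
  refine (M.lintegral_epochLaw_eval hπ h (F := fun z => ENNReal.ofReal (Real.exp
    ((∫ s, M.meanSq h ξ ζ s ∂M.evalLaw b (greedyPolicy σ (sel k D)) h z.1) / 32 -
      M.excess h ξ ζ z / 8))) ?_).trans_le ?_
  · exact ENNReal.measurable_ofReal.comp (Real.measurable_exp.comp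
      (((hc.comp measurable_fst).div_const 32).sub ((measurable_excess hξ hζ).div_const 8)))
  · exact lintegral_exp_tupleLaw_le b (fun m hm => hπ m (hm.trans h.2))
      (fun s a => ha.reward_le h.2 s a) hξ hζ

/-- Union bound over epochs, steps and cover centres. The factor `2` accounts for the flag `o`, that
is, for targets built from `Q⋆` or from the centre itself. -/
theorem measure_not_noDeviation_le (hsel : M.IsVGolf F G σ K β sel)
    (ha : M.Admissible F G σ) (b : Bool)
    {W : Finset (ℕ → S → A → ℝ)} (hW : (W : Set (ℕ → S → A → ℝ)) ⊆ M.tuples F ∪ M.tuples G) :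
    M.dataLaw σ sel K {D | ¬ M.NoDeviation b σ sel W θ D} ≤
      ENNReal.ofReal (2 * (K * M.H * W.card) * Real.exp (-θ)) := by
  have hsub : {D | ¬ M.NoDeviation b σ sel W θ D} ⊆
      ⋃ x ∈ (Finset.univ : Finset (Fin K × Fin M.H × Bool)) ×ˢ W,
        {D | θ ≤ M.deviation (M.testLaw b σ sel (pre D x.1.1 x.1.1.2.le) x.1.2.1) x.1.2.1
          (x.2 x.1.2.1) (if x.1.2.2 then M.qs (x.1.2.1 + 1) else x.2 (x.1.2.1 + 1))
          (pre D x.1.1 x.1.1.2.le)} := by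
    intro D hD
    simp only [NoDeviation, Set.mem_ofPred_eq, not_forall, not_lt] at hD
    obtain ⟨k, h, w, hw, o, hD⟩ := hD
    exact Set.mem_biUnion (x := ((k, h, o), w)) (by simpa using hw) hD
  refine (measure_mono hsub).trans ((measure_biUnion_finset_le _ _).trans ?_)
  have hunit : ∀ w ∈ W, ∀ h, UnitValued (w h) := fun w hw h =>
    (hW hw).elim (fun H => ha.valF.unitValued H h) fun H => ha.valG.unitValued H h
  refine (Finset.sum_le_card_nsmul _ _ (ENNReal.ofReal (Real.exp (-θ))) fun x hx => ?_).trans ?_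
  · have hw : x.2 ∈ W := (Finset.mem_product.1 hx).2
    refine hsel.measure_deviation_ge_le ha b x.1.1.2.le x.1.2.1 (hunit _ hw _) ?_
    split_ifs
    · exact ha.valF.unitValued ha.qs_mem _
    · exact hunit _ hw _
  · rw [nsmul_eq_mul, ← ENNReal.ofReal_natCast, ← ENNReal.ofReal_mul (Nat.cast_nonneg _)]
    refine ENNReal.ofReal_le_ofReal (le_of_eq ?_)
    simp only [Finset.card_product, Finset.card_univ, Fintype.card_prod, Fintype.card_fin,
      Fintype.card_bool]
    push_cast
    ring

theorem ae_reward_mem (hsel : M.IsVGolf F G σ K β sel) (ha : M.Admissible F G σ) :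
    ∀ᵐ D ∂M.dataLaw σ sel K, ∀ i h, (D i h).2.2.1 ∈ Set.Icc (0 : ℝ) 1 := by
  have hms : MeasurableSet {z : S × A × ℝ × S | z.2.2.1 ∈ Set.Icc (0 : ℝ) 1} :=
    measurable_snd.snd.fst measurableSet_Icc
  have hset : MeasurableSet {e : M.Epoch | ∀ h, (e h).2.2.1 ∈ Set.Icc (0 : ℝ) 1} := by
    rw [Set.ofPred_forall]
    refine MeasurableSet.iInter fun h => ?_
    have h1 : Measurable fun e : M.Epoch => (e h).2.2.1 := (measurable_pi_apply h).snd.snd.fst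
    exact h1 measurableSet_Icc
  rw [dataLaw_eq]
  refine (hsel.isSampling ha).ae_forall hset fun k hk D => ?_
  rw [show (∀ᵐ e ∂M.sampling σ sel k D, e ∈ {e : M.Epoch | ∀ h, (e h).2.2.1 ∈ Set.Icc (0 : ℝ) 1}) ↔
    ∀ᵐ e ∂M.sampling σ sel k D, ∀ h, (e h).2.2.1 ∈ Set.Icc (0 : ℝ) 1 from Iff.rfl, ae_all_iff]
  intro h
  have hm : Measurable ({z : S × A × ℝ × S | z.2.2.1 ∈ Set.Icc (0 : ℝ) 1}ᶜ.indicator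
      (1 : S × A × ℝ × S → ℝ≥0∞)) := measurable_one.indicator hms.compl
  have h0 : ∫⁻ e, {z : S × A × ℝ × S | z.2.2.1 ∈ Set.Icc (0 : ℝ) 1}ᶜ.indicator 1 (e h)
      ∂M.sampling σ sel k D = 0 := by
    rw [sampling, M.lintegral_epochLaw_eval (fun m hm =>
      ha.measurable_greedyPolicy (hsel.mem k hk D) hm) h hm, M.lintegral_tupleLaw hm]
    have : ∀ s a, M.r h s a ∈ Set.Icc (0 : ℝ) 1 := fun s a =>
      ⟨M.r_nonneg _ _ _, ha.reward_le h.2 s a⟩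
    simp only [Set.indicator, Set.mem_compl_iff, Set.mem_ofPred_eq, this, not_true_eq_false,
      if_false, lintegral_zero, Finset.sum_const_zero, mul_zero]
  filter_upwards [(lintegral_eq_zero_iff (hm.comp (measurable_pi_apply h))).1 h0] with e he
  by_contra hc
  simp only [Function.comp_apply, Set.indicator, Set.mem_compl_iff, Set.mem_ofPred_eq, hc,
    not_false_eq_true, if_true, Pi.one_apply, Pi.zero_apply, one_ne_zero] at he

/-- The deviations with `o = true` keep `Q⋆` in the confidence set, so that the set is nonempty and
its maximizer is optimistic; those with `o = false` bound the past residuals of that maximizer. -/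
theorem good_of_noDeviation (hsel : M.IsVGolf F G σ K β sel)
    (ha : M.Admissible F G σ) (b : Bool) {W : Finset (ℕ → S → A → ℝ)}
    (hW : (W : Set (ℕ → S → A → ℝ)) ⊆ M.tuples F ∪ M.tuples G)
    (hcov : ∀ f ∈ M.tuples F ∪ M.tuples G, ∃ w ∈ W, ∀ h s a, |f h s a - w h s a| ≤ ρ)
    (hρ : 0 ≤ ρ) (hβ : 8 * θ + 16 * (K * ρ) ≤ β) {D : Fin K → M.Epoch}
    (hD : ∀ i h, (D i h).2.2.1 ∈ Set.Icc (0 : ℝ) 1) (hdev : M.NoDeviation b σ sel W θ D)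
    (k : Fin K) :
    mx (M.qs 0) M.s₁ ≤ mx (sel k (pre D k k.2.le) 0) M.s₁ ∧ ∀ h,
      M.SmallPast b σ sel (Fintype.card A * (32 * θ + 4 * β + 72 * (K * ρ))) h
        (pre D k k.2.le) := by
  have hkρ : (k : ℝ) * ρ ≤ K * ρ :=
    mul_le_mul_of_nonneg_right (by exact_mod_cast k.2.le) hρ
  have hD' : ∀ i h, (pre D k k.2.le i h).2.2.1 ∈ Set.Icc (0 : ℝ) 1 := fun i h => hD _ h
  have hq := ha.qs_mem_confidenceSet hW hcov hD' hρ
    (ν := fun h => M.testLaw b σ sel (pre D k k.2.le) h) (θ := θ) (β := β)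
    (fun h w hw => (by simpa using hdev k h w hw true : _ < θ).le) (by linarith)
  obtain ⟨hmem, hmax⟩ := hsel.argmax k k.2 (pre D k k.2.le) ⟨_, hq⟩
  refine ⟨?_, fun h => ?_⟩
  · rw [ha.mx_eq ha.qs_mem M.H_pos, ha.mx_eq (hsel.mem k k.2 _) M.H_pos]
    exact hmax _ hq
  · have := fun i => hsel.isProbabilityMeasure_testLaw ha b k.2.le (pre D k k.2.le) h i
    refine (ha.sum_sq_residual_le hW hcov hD' (θ := θ)
      (fun w hw => (by simpa using hdev k h w hw false : _ < θ).le) hmem).trans ?_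
    refine mul_le_mul_of_nonneg_left ?_ (Nat.cast_nonneg _)
    linarith

end GoodEvent

end IsVGolf

end MDP

end

/-! ### From residuals to the suboptimality of the output -/

noncomputable section

theorem sum_castLE_eq_sum_Iio {K : ℕ} {R : Type*} [AddCommMonoid R] (k : Fin K) (f : Fin K → R) :
    ∑ i : Fin k, f (Fin.castLE k.2.le i) = ∑ i ∈ Finset.Iio k, f i := by
  refine Finset.sum_bij (fun i _ => Fin.castLE k.2.le i)
    (fun i _ => Finset.mem_Iio.2 (Fin.lt_def.2 i.2))
    (fun _ _ _ _ h => Fin.castLE_injective _ h)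
    (fun i hi => ⟨⟨i, Fin.lt_def.1 (Finset.mem_Iio.1 hi)⟩, Finset.mem_univ _, rfl⟩)
    fun _ _ => rfl

namespace MDP

variable {S A : Type*} [MeasurableSpace S] [MeasurableSpace A] {M : MDP S A}
  [MeasurableSingletonClass A] [Fintype A] [Nonempty A]
  {F G : ℕ → Set (S → A → ℝ)} {σ : ℕ → (S → A → ℝ) → S → A} {K : ℕ} {β Γ : ℝ}
  {sel : (k : ℕ) → (Fin k → M.Epoch) → ℕ → S → A → ℝ}

/-- Sum over the steps of the tested residuals of the function chosen after the data `D`, over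
those steps at which its residuals on the past are small. -/
def nextError (M : MDP S A) (b : Bool) (σ : ℕ → (S → A → ℝ) → S → A)
    (sel : (k : ℕ) → (Fin k → M.Epoch) → ℕ → S → A → ℝ) (Γ : ℝ) {k : ℕ} (D : Fin k → M.Epoch)
    (e : M.Epoch) : ℝ≥0∞ :=
  ∑ h : Fin M.H, {D : Fin k → M.Epoch | M.SmallPast b σ sel Γ h D}.indicator
    (fun D => ‖∫ s, M.residual σ (sel k D) h s
      ∂M.evalLaw b (greedyPolicy σ (sel k D)) h (e h).1‖ₑ) D

/-- Expectation of `nextError` over the data of the next epoch. -/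
def meanError (M : MDP S A) (b : Bool) (σ : ℕ → (S → A → ℝ) → S → A)
    (sel : (k : ℕ) → (Fin k → M.Epoch) → ℕ → S → A → ℝ) (Γ : ℝ) {k : ℕ} (D : Fin k → M.Epoch) :
    ℝ≥0∞ :=
  ∫⁻ e, M.nextError b σ sel Γ D e ∂M.sampling σ sel k D

/-- The family of state distributions in which the test laws lie. -/
def testFamily (M : MDP S A) (b : Bool) (F : ℕ → Set (S → A → ℝ))
    (σ : ℕ → (S → A → ℝ) → S → A) : ℕ → Set (Measure S) :=
  if b then diracLaws S else M.rollInLaws F σ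

namespace IsVGolf

theorem measurable_nextError (hsel : M.IsVGolf F G σ K β sel)
    (ha : M.Admissible F G σ) (b : Bool) {k : ℕ} (hk : k < K) :
    Measurable (Function.uncurry fun (D : Fin k → M.Epoch) e => M.nextError b σ sel Γ D e) := by
  have hr : ∀ h : Fin M.H, Measurable fun p : (Fin k → M.Epoch) × S =>
      M.residual σ (sel k p.1) h p.2 := fun h => hsel.measurable_residual_param hk h.2
  have hset : ∀ h, MeasurableSet {D : Fin k → M.Epoch | M.SmallPast b σ sel Γ h D} := fun h => by
    have h1 : ∀ i, Measurable fun D : Fin k → M.Epoch =>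
        ∫ s, M.residual σ (sel k D) h s ∂M.testLaw b σ sel D h i := fun i =>
      measurable_integral_param (hsel.measurable_testLaw b hk.le h i)
        (fun D => hsel.isProbabilityMeasure_testLaw ha b hk.le D h i) (hr h)
    exact measurableSet_le (Finset.measurable_sum _ fun i _ => (h1 i).pow_const 2)
      measurable_const
  have hi : ∀ h : Fin M.H, Measurable fun p : (Fin k → M.Epoch) × M.Epoch =>
      ∫ s, M.residual σ (sel k p.1) h s
        ∂M.evalLaw b (greedyPolicy σ (sel k p.1)) h (p.2 h).1 := fun h =>
    measurable_integral_param (g := fun (p : (Fin k → M.Epoch) × M.Epoch) s =>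
      M.residual σ (sel k p.1) h s) (hsel.measurable_evalLaw_next b hk h)
      (fun p => hsel.isProbabilityMeasure_evalLaw_next ha b hk h p.1 _)
      ((hr h).comp (measurable_fst.fst.prodMk measurable_snd))
  have hs : Measurable fun p : (Fin k → M.Epoch) × M.Epoch => ∑ h : Fin M.H,
      (Prod.fst ⁻¹' {D : Fin k → M.Epoch | M.SmallPast b σ sel Γ h D}).indicator
        (fun p : (Fin k → M.Epoch) × M.Epoch => ‖∫ s, M.residual σ (sel k p.1) h s
          ∂M.evalLaw b (greedyPolicy σ (sel k p.1)) h (p.2 h).1‖ₑ) p :=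
    Finset.measurable_sum _ fun h _ => (hi h).enorm.indicator (measurable_fst (hset h))
  exact hs

/-- The indicator in `nextError` discards the epochs whose past residuals are not small, so the
Eluder bound holds for every data sequence, not only on the good event. It can thus be integrated
without conditioning on an event that depends on the future. -/
theorem sum_nextError_le (hsel : M.IsVGolf F G σ K β sel)
    (ha : M.Admissible F G σ) (b : Bool) {ε : ℝ} (hε : 0 < ε) (hΓ : 0 ≤ Γ)
    {d : ℕ} (hd : M.dimVBE F σ (M.testFamily b F σ) ε ≤ d) (D : Fin K → M.Epoch) :
    ∑ k : Fin K, M.nextError b σ sel Γ (pre D k k.2.le) (D k) ≤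
      ENNReal.ofReal (M.H * (2 * ε * K + 2 * d + 1 + 6 * Real.sqrt (d * Γ * K))) := by
  classical
  have hmem : ∀ k : Fin K, sel k (pre D k k.2.le) ∈ M.tuples F := fun k => hsel.mem k k.2 _
  have key : ∀ h : Fin M.H, ∑ k : Fin K,
      {D : Fin k → M.Epoch | M.SmallPast b σ sel Γ h D}.indicator
        (fun D' => ‖∫ s, M.residual σ (sel k D') h s
          ∂M.evalLaw b (greedyPolicy σ (sel k D')) h (D k h).1‖ₑ) (pre D k k.2.le) ≤
      ENNReal.ofReal (2 * ε * K + 2 * d + 1 + 6 * Real.sqrt (d * Γ * K)) := by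
    intro h
    have hp := fun k => hsel.isProbabilityMeasure_testLaw ha b le_rfl D h k
    have hdh : dimDE (M.residualClass F σ h) (M.testFamily b F σ h) ε ≤ d :=
      (le_iSup (fun h : Fin M.H => dimDE (M.residualClass F σ h) (M.testFamily b F σ h) ε)
        h).trans hd
    have hbound := sum_abs_le_of_dimDE hdh hε hΓ (K := K) (μ := fun k => M.testLaw b σ sel D h k)
      (φ := fun k => M.residual σ (sel k (pre D k k.2.le)) h)
      (Finset.univ.filter fun k : Fin K => M.SmallPast b σ sel Γ h (pre D k k.2.le))
      (fun k => by
        cases b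
        · exact ⟨_, hmem k, rfl⟩
        · exact ⟨_, rfl⟩)
      (fun k => ⟨_, hmem k, rfl⟩)
      (fun k hk => by
        rw [← sum_castLE_eq_sum_Iio k fun i =>
          (∫ s, M.residual σ (sel k (pre D k k.2.le)) h s ∂M.testLaw b σ sel D h i) ^ 2]
        exact (Finset.mem_filter.1 hk).2)
      (fun k => by
        simpa using norm_integral_le_of_norm_le_const (μ := M.testLaw b σ sel D h k)
          (f := M.residual σ (sel k (pre D k k.2.le)) h)
          (.of_forall (ha.abs_residual_le_one (hmem k) h.2)))
    refine le_trans (le_of_eq ?_) (ENNReal.ofReal_le_ofReal hbound)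
    rw [ENNReal.ofReal_sum_of_nonneg fun _ _ => abs_nonneg _, Finset.sum_filter]
    refine Finset.sum_congr rfl fun k _ => ?_
    simp only [Set.indicator, Set.mem_ofPred_eq, Real.enorm_eq_ofReal_abs]
    rfl
  simp only [nextError]
  rw [Finset.sum_comm]
  refine (Finset.sum_le_card_nsmul _ _ _ fun h _ => key h).trans (le_of_eq ?_)
  rw [Finset.card_univ, Fintype.card_fin, nsmul_eq_mul, ENNReal.ofReal_mul (Nat.cast_nonneg _),
    ENNReal.ofReal_natCast]

/-- For point masses this is the triangle inequality, since the state observed at step `h` has the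
roll-in law. For roll-in laws the right-hand integrand is constant. -/
theorem enorm_integral_residual_le (hsel : M.IsVGolf F G σ K β sel)
    (ha : M.Admissible F G σ) (b : Bool) {k : ℕ} (hk : k < K)
    (D : Fin k → M.Epoch) (h : Fin M.H) :
    ‖∫ s, M.residual σ (sel k D) h s ∂M.stateLaw (greedyPolicy σ (sel k D)) 0 M.s₁ h‖ₑ ≤
      ∫⁻ e, ‖∫ s, M.residual σ (sel k D) h s
        ∂M.evalLaw b (greedyPolicy σ (sel k D)) h (e h).1‖ₑ ∂M.sampling σ sel k D := by
  have hf := hsel.mem k hk D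
  have hm := ha.measurable_residual hf h.2
  have hp := (hsel.isSampling ha).prob k hk D
  cases b
  · simp [evalLaw]
  · simp only [evalLaw, if_true]
    simp_rw [integral_dirac' _ _ hm.stronglyMeasurable]
    refine (enorm_integral_le_lintegral_enorm _).trans (le_of_eq ?_)
    rw [sampling, M.lintegral_epochLaw_eval (fun m hm => ha.measurable_greedyPolicy hf hm) h
      (F := fun z => ‖M.residual σ (sel k D) h z.1‖ₑ) (hm.enorm.comp measurable_fst)]
    exact (M.lintegral_tupleLaw_fst hm.enorm).symm

/-- Optimism bounds the gap by the overestimate of the chosen function at `s₁`, which is a sum of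
expected residuals by `mx_sub_V_greedy`. Under `hsmall` all indicators in `nextError` equal `1`. -/
theorem ofReal_gap_le (hsel : M.IsVGolf F G σ K β sel)
    (ha : M.Admissible F G σ) (b : Bool) {k : ℕ} (hk : k < K)
    (D : Fin k → M.Epoch) (hopt : mx (M.qs 0) M.s₁ ≤ mx (sel k D 0) M.s₁)
    (hsmall : ∀ h, M.SmallPast b σ sel Γ h D) :
    ENNReal.ofReal (M.Vstar 0 M.s₁ - M.V (greedyPolicy σ (sel k D)) 0 M.s₁) ≤
      ∫⁻ e, M.nextError b σ sel Γ D e ∂M.sampling σ sel k D := by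
  have h1 : M.Vstar 0 M.s₁ - M.V (greedyPolicy σ (sel k D)) 0 M.s₁ ≤ ∑ h : Fin M.H,
      |∫ s, M.residual σ (sel k D) h s ∂M.stateLaw (greedyPolicy σ (sel k D)) 0 M.s₁ h| := by
    have h2 := ha.mx_sub_V_greedy (hsel.mem k hk D)
    have h3 := ha.Vstar_le
    have h4 := Finset.sum_le_sum fun (h : Fin M.H) (_ : h ∈ Finset.univ) => le_abs_self
      (∫ s, M.residual σ (sel k D) h s ∂M.stateLaw (greedyPolicy σ (sel k D)) 0 M.s₁ h)
    linarith
  refine (ENNReal.ofReal_le_ofReal h1).trans ?_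
  rw [ENNReal.ofReal_sum_of_nonneg fun _ _ => abs_nonneg _]
  have hm : ∀ h : Fin M.H, Measurable fun e : M.Epoch => ‖∫ s, M.residual σ (sel k D) h s
      ∂M.evalLaw b (greedyPolicy σ (sel k D)) h (e h).1‖ₑ := fun h =>
    (measurable_integral_param (g := fun (_ : M.Epoch) s => M.residual σ (sel k D) h s)
      ((hsel.measurable_evalLaw_next b hk h).comp measurable_prodMk_left)
      (fun e => hsel.isProbabilityMeasure_evalLaw_next ha b hk h D _)
      ((ha.measurable_residual (hsel.mem k hk D) h.2).comp measurable_snd)).enorm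
  have h5 : ∀ e, M.nextError b σ sel Γ D e = ∑ h : Fin M.H, ‖∫ s, M.residual σ (sel k D) h s
      ∂M.evalLaw b (greedyPolicy σ (sel k D)) h (e h).1‖ₑ := fun e =>
    Finset.sum_congr rfl fun h _ => Set.indicator_of_mem
      (s := {D : Fin k → M.Epoch | M.SmallPast b σ sel Γ h D}) (hsmall h) _
  simp_rw [h5]
  rw [lintegral_finsetSum _ fun h _ => hm h]
  refine Finset.sum_le_sum fun h _ => ?_
  rw [← Real.enorm_eq_ofReal_abs]
  exact hsel.enorm_integral_residual_le ha b hk D h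

theorem measurable_meanError (hsel : M.IsVGolf F G σ K β sel)
    (ha : M.Admissible F G σ) (b : Bool) {k : ℕ} (hk : k < K) :
    Measurable fun D : Fin K → M.Epoch => M.meanError b σ sel Γ (pre D k hk.le) := by
  have h1 : Measurable fun D : Fin k → M.Epoch => M.meanError b σ sel Γ D :=
    measurable_lintegral_param ((hsel.isSampling ha).meas k hk) ((hsel.isSampling ha).prob k hk)
      (hsel.measurable_nextError ha b hk)
  exact h1.comp (measurable_pre hk.le)

/-- By the tower property, the conditional means have the same total expectation as the realized
errors, and these obey the bound for every data sequence. -/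
theorem sum_lintegral_meanError_le (hsel : M.IsVGolf F G σ K β sel)
    (ha : M.Admissible F G σ) (b : Bool) {ε : ℝ} (hε : 0 < ε)
    (hΓ : 0 ≤ Γ) {d : ℕ} (hd : M.dimVBE F σ (M.testFamily b F σ) ε ≤ d) :
    ∑ k : Fin K, ∫⁻ D, M.meanError b σ sel Γ (pre D k k.2.le) ∂M.dataLaw σ sel K ≤
      ENNReal.ofReal (M.H * (2 * ε * K + 2 * d + 1 + 6 * Real.sqrt (d * Γ * K))) := by
  have hs := hsel.isSampling ha
  have hprob := hs.isProbabilityMeasure K le_rfl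
  have hnext : ∀ k : Fin K, Measurable fun D : Fin K → M.Epoch =>
      M.nextError b σ sel Γ (pre D k k.2.le) (D k) := fun k => by
    have h1 : Measurable fun D : Fin K → M.Epoch => pre D k k.2.le := measurable_pre k.2.le
    have h2 : Measurable fun D : Fin K → M.Epoch => D k := measurable_pi_apply k
    have h3 := (hsel.measurable_nextError (Γ := Γ) ha b k.2).comp (h1.prodMk h2)
    exact h3
  rw [dataLaw_eq]
  have h1 : ∀ k : Fin K, ∫⁻ D, M.meanError b σ sel Γ (pre D k k.2.le)
      ∂adaptiveLaw (M.sampling σ sel) K =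
      ∫⁻ D, M.nextError b σ sel Γ (pre D k k.2.le) (D k) ∂adaptiveLaw (M.sampling σ sel) K :=
    fun k => (hs.lintegral_next k.2 (hsel.measurable_nextError ha b k.2)).symm
  simp_rw [h1]
  rw [← lintegral_finsetSum _ fun k _ => hnext k]
  refine (lintegral_mono (hsel.sum_nextError_le ha b hε hΓ hd)).trans (le_of_eq ?_)
  rw [lintegral_const, measure_univ, mul_one]

/-- Probability guarantee for the output, in terms of the failure probability of the concentration
event and of the total error over `K` epochs. -/
theorem outputProb_ge (hsel : M.IsVGolf F G σ K β sel)
    (ha : M.Admissible F G σ) (b : Bool) {ε θ ρ η δ : ℝ} (hε : 0 < ε)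
    {d : ℕ} (hd : M.dimVBE F σ (M.testFamily b F σ) ε ≤ d) {W : Finset (ℕ → S → A → ℝ)}
    (hW : (W : Set (ℕ → S → A → ℝ)) ⊆ M.tuples F ∪ M.tuples G)
    (hcov : ∀ f ∈ M.tuples F ∪ M.tuples G, ∃ w ∈ W, ∀ h s a, |f h s a - w h s a| ≤ ρ)
    (hρ : 0 ≤ ρ) (hθ : 0 ≤ θ) (hβ : 8 * θ + 16 * (K * ρ) ≤ β) (hK : 0 < K) (hη : 0 < η)
    (hδ : 0 ≤ δ)
    (hfail : 2 * (K * M.H * W.card) * Real.exp (-θ) ≤ δ)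
    (herr : M.H * (2 * ε * K + 2 * d + 1 + 6 * Real.sqrt
      (d * (Fintype.card A * (32 * θ + 4 * β + 72 * (K * ρ))) * K)) ≤ δ * (K * η)) :
    ENNReal.ofReal (1 - 2 * δ) ≤ M.outputProb σ sel K (M.IsOptimalUpTo η) := by
  set Γ : ℝ := Fintype.card A * (32 * θ + 4 * β + 72 * (K * ρ)) with hΓdef
  have hKρ : 0 ≤ K * ρ := by positivity
  have hΓ : 0 ≤ Γ := mul_nonneg (Nat.cast_nonneg _) (by linarith)
  have hs := hsel.isSampling ha
  have hprob : IsProbabilityMeasure (M.dataLaw σ sel K) := by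
    rw [dataLaw_eq]; exact hs.isProbabilityMeasure K le_rfl
  have : Nonempty (Fin K) := ⟨⟨0, hK⟩⟩
  set μ := (M.dataLaw σ sel K).prod (uniformOn (Set.univ : Set (Fin K))) with hμ
  let Y : (Fin K → M.Epoch) × Fin K → ℝ≥0∞ := fun x =>
    M.meanError b σ sel Γ (pre x.1 x.2 x.2.2.le)
  have hYk : ∀ k : Fin K, Measurable fun D => Y (D, k) := fun k =>
    hsel.measurable_meanError ha b k.2
  have hY : Measurable Y := measurable_from_prod_countable_left hYk
  have hint : ∫⁻ x, Y x ∂μ ≤ ENNReal.ofReal (δ * η) := by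
    rw [hμ, lintegral_prod _ hY.aemeasurable]
    simp_rw [lintegral_uniformOn_univ]
    rw [lintegral_const_mul _ (Finset.measurable_sum _ fun k _ => hYk k),
      lintegral_finsetSum _ fun k _ => hYk k]
    refine (mul_le_mul_right (hsel.sum_lintegral_meanError_le ha b hε hΓ hd) _).trans ?_
    have hK' : (0 : ℝ) < K := by exact_mod_cast hK
    rw [Fintype.card_fin, ← ENNReal.ofReal_natCast, ← ENNReal.ofReal_inv_of_pos hK',
      ← ENNReal.ofReal_mul (inv_nonneg.2 hK'.le)]
    refine ENNReal.ofReal_le_ofReal ?_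
    rw [inv_mul_le_iff₀ hK']
    linarith
  -- Markov's inequality is applied jointly to the data and the random index, so the average over
  -- the epochs directly controls the random output.
  have hmarkov : μ {x | ENNReal.ofReal η ≤ Y x} ≤ ENNReal.ofReal δ := by
    refine (meas_ge_le_lintegral_div hY.aemeasurable (by simpa using hη)
      ENNReal.ofReal_ne_top).trans ?_
    refine (ENNReal.div_le_div_right hint _).trans (le_of_eq ?_)
    rw [← ENNReal.ofReal_div_of_pos hη, mul_div_cancel_right₀ _ hη.ne']
  set Bad : Set (Fin K → M.Epoch) := {D | ¬ M.NoDeviation b σ sel W θ D} ∪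
    {D | ¬∀ i h, (D i h).2.2.1 ∈ Set.Icc (0 : ℝ) 1} with hBad
  have hbad : μ (Bad ×ˢ Set.univ) ≤ ENNReal.ofReal δ := by
    rw [hμ, Measure.prod_prod, measure_univ, mul_one, hBad]
    refine (measure_union_le _ _).trans ?_
    have h0 : M.dataLaw σ sel K {D | ¬∀ i h, (D i h).2.2.1 ∈ Set.Icc (0 : ℝ) 1} = 0 :=
      hsel.ae_reward_mem ha
    rw [h0, add_zero]
    exact (hsel.measure_not_noDeviation_le ha b hW).trans (ENNReal.ofReal_le_ofReal hfail)
  -- The event in question is bounded through its complement by subadditivity alone; neither it nor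
  -- `Bad` has to be measurable.
  have hcover : (Set.univ : Set ((Fin K → M.Epoch) × Fin K)) ⊆
      {x | M.IsOptimalUpTo η (M.policyAt σ sel x.1 x.2)} ∪
        (Bad ×ˢ Set.univ ∪ {x | ENNReal.ofReal η ≤ Y x}) := by
    rintro ⟨D, k⟩ -
    by_cases hB : D ∈ Bad
    · exact Or.inr (Or.inl ⟨hB, Set.mem_univ _⟩)
    by_cases ho : M.IsOptimalUpTo η (M.policyAt σ sel D k)
    · exact Or.inl ho
    refine Or.inr (Or.inr ?_)
    have hB1 : M.NoDeviation b σ sel W θ D := by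
      by_contra hc; exact hB (Or.inl hc)
    have hB2 : ∀ i h, (D i h).2.2.1 ∈ Set.Icc (0 : ℝ) 1 := by
      by_contra hc; exact hB (Or.inr hc)
    obtain ⟨hopt, hsmall⟩ := hsel.good_of_noDeviation ha b hW hcov hρ hβ hB2 hB1 k
    refine le_trans (ENNReal.ofReal_le_ofReal ?_)
      (hsel.ofReal_gap_le ha b k.2 (pre D k k.2.le) hopt hsmall)
    rw [IsOptimalUpTo, policyAt_eq, not_le] at ho
    linarith
  have htot : 1 ≤ M.outputProb σ sel K (M.IsOptimalUpTo η) +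
      (ENNReal.ofReal δ + ENNReal.ofReal δ) := by
    calc 1 = μ Set.univ := measure_univ.symm
      _ ≤ _ := measure_mono hcover
      _ ≤ _ := (measure_union_le _ _).trans (add_le_add le_rfl
        ((measure_union_le _ _).trans (add_le_add hbad hmarkov)))
  rw [← ENNReal.ofReal_add hδ hδ, ← two_mul] at htot
  rw [ENNReal.ofReal_sub _ (by linarith), ENNReal.ofReal_one]
  exact tsub_le_iff_right.2 htot

end IsVGolf

end MDP

end

/-! ### Numerical estimates for the choice of `K`, `β` and `θ` -/

noncomputable section

section Rates

variable {H d a N K : ℕ} {ε : ℝ}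

theorem two_le_sampleSize_arg (hH : 1 ≤ H) (hd : 1 ≤ d) (ha : 1 ≤ a) (hN : 1 ≤ N) (hε : 0 < ε)
    (hε2 : ε < 1 / 2) : 2 * (H * d * a * N : ℝ) ≤ N * ((H : ℝ) * d * a / ε) := by
  rw [← mul_div_assoc, le_div_iff₀ hε]
  have h1 : (1 : ℝ) ≤ H := by exact_mod_cast hH
  have h2 : (1 : ℝ) ≤ d := by exact_mod_cast hd
  have h3 : (1 : ℝ) ≤ a := by exact_mod_cast ha
  have h4 : (1 : ℝ) ≤ N := by exact_mod_cast hN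
  have h5 : (0 : ℝ) < H * d * a * N := by positivity
  nlinarith

theorem inv_scale (ε : ℝ) : (scale H d a ε)⁻¹ = (H : ℝ) ^ 2 * d * a / ε ^ 2 := by
  rw [scale, inv_div]

theorem sampleSize_eq (ε : ℝ) : sampleSize H d a N ε =
    (scale H d a ε)⁻¹ * Real.log (N * ((H : ℝ) * d * a / ε)) := by
  rw [inv_scale]; rfl

theorem scale_pos (hH : 1 ≤ H) (hd : 1 ≤ d) (ha : 1 ≤ a) (hε : 0 < ε) : 0 < scale H d a ε := by
  have h1 : (1 : ℝ) ≤ H := by exact_mod_cast hH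
  have h2 : (1 : ℝ) ≤ d := by exact_mod_cast hd
  have h3 : (1 : ℝ) ≤ a := by exact_mod_cast ha
  exact div_pos (by positivity) (by positivity)

theorem log_two_le_log_arg (hH : 1 ≤ H) (hd : 1 ≤ d) (ha : 1 ≤ a) (hN : 1 ≤ N) (hε : 0 < ε)
    (hε2 : ε < 1 / 2) : 0.69 ≤ Real.log (N * ((H : ℝ) * d * a / ε)) := by
  have h0 : (1 : ℝ) ≤ H * d * a * N := by
    exact_mod_cast Nat.one_le_iff_ne_zero.2 (by positivity : H * d * a * N ≠ 0)
  have h1 := two_le_sampleSize_arg hH hd ha hN hε hε2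
  have h2 := Real.log_le_log two_pos (show (2 : ℝ) ≤ N * ((H : ℝ) * d * a / ε) by linarith)
  linarith [Real.log_two_gt_d9]

theorem inv_scale_le (hH : 1 ≤ H) (hd : 1 ≤ d) (ha : 1 ≤ a) (hN : 1 ≤ N) (hε : 0 < ε)
    (hε2 : ε < 1 / 2) (hK : sampleSize H d a N ε ≤ K) : 0.69 * (scale H d a ε)⁻¹ ≤ K := by
  rw [sampleSize_eq] at hK
  have h1 := log_two_le_log_arg hH hd ha hN hε hε2
  have h2 := inv_pos.2 (scale_pos hH hd ha hε)
  nlinarith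

theorem three_le_of_sampleSize_le (hH : 1 ≤ H) (hd : 1 ≤ d) (ha : 1 ≤ a) (hN : 1 ≤ N)
    (hε : 0 < ε) (hε2 : ε < 1 / 2) (hK : sampleSize H d a N ε ≤ K) : 3 ≤ K := by
  have h1 := inv_scale_le hH hd ha hN hε hε2 hK
  have h2 : (4 : ℝ) ≤ (scale H d a ε)⁻¹ := by
    rw [inv_scale, le_div_iff₀ (by positivity)]
    have : (1 : ℝ) ≤ (H : ℝ) ^ 2 * d * a := by
      exact_mod_cast Nat.one_le_iff_ne_zero.2 (by positivity : H ^ 2 * d * a ≠ 0)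
    nlinarith
  have h3 : (2 : ℝ) < K := by linarith
  exact_mod_cast h3

theorem steps_mul_dim_le (hH : 1 ≤ H) (hd : 1 ≤ d) (ha : 1 ≤ a) (hN : 1 ≤ N) (hε : 0 < ε)
    (hε2 : ε < 1 / 2) (hK : sampleSize H d a N ε ≤ K) : (H * d : ℝ) ≤ K * ε := by
  have h1 := inv_scale_le hH hd ha hN hε hε2 hK
  rw [inv_scale] at h1
  have h2 : (1 : ℝ) ≤ H := by exact_mod_cast hH
  have h3 : (1 : ℝ) ≤ a := by exact_mod_cast ha
  have h4 : (0 : ℝ) < H * d := by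
    exact_mod_cast Nat.pos_of_ne_zero (by positivity : H * d ≠ 0)
  have h5 : (H * d : ℝ) ≤ (H : ℝ) ^ 2 * d * a := by
    have : (1 : ℝ) ≤ H * a := by nlinarith
    nlinarith
  have h6 : 0.69 * ((H : ℝ) ^ 2 * d * a / ε ^ 2) * ε = 0.69 * ((H : ℝ) ^ 2 * d * a) / ε := by
    field_simp
  have h7 : (H * d : ℝ) ≤ 0.69 * ((H : ℝ) ^ 2 * d * a) / ε := by
    rw [le_div_iff₀ hε]; nlinarith
  nlinarith

theorem log_arg_le (hH : 1 ≤ H) (hd : 1 ≤ d) (ha : 1 ≤ a) (hN : 1 ≤ N) (hε : 0 < ε)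
    (hε2 : ε < 1 / 2) (hK : sampleSize H d a N ε ≤ K) :
    Real.log (N * ((H : ℝ) * d * a / ε)) ≤ Real.log (K * H * N) := by
  have h0 := two_le_sampleSize_arg hH hd ha hN hε hε2
  have h1 := inv_scale_le hH hd ha hN hε hε2 hK
  rw [inv_scale] at h1
  have h2 : (1 : ℝ) ≤ H := by exact_mod_cast hH
  have h3 : (0 : ℝ) < H * d * a * N := by
    exact_mod_cast Nat.pos_of_ne_zero (by positivity : H * d * a * N ≠ 0)
  have h4 : (0 : ℝ) < N := by exact_mod_cast hN
  have h5 : (0 : ℝ) < (H : ℝ) ^ 2 * d * a := by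
    exact_mod_cast Nat.pos_of_ne_zero (by positivity : H ^ 2 * d * a ≠ 0)
  refine Real.log_le_log (by linarith) ?_
  have h6 : (H : ℝ) * d * a / ε ≤ K * H := by
    have h7 : (H : ℝ) * d * a / ε ≤ 0.69 * ((H : ℝ) ^ 2 * d * a / ε ^ 2) := by
      rw [← mul_div_assoc, div_le_div_iff₀ hε (by positivity)]
      have : (H : ℝ) * d * a ≤ (H : ℝ) ^ 2 * d * a := by
        have : (0 : ℝ) ≤ H * d * a := by positivity
        nlinarith
      nlinarith [mul_pos h5 hε]
    have h8 : (K : ℝ) ≤ K * H := le_mul_of_one_le_right (Nat.cast_nonneg _) h2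
    linarith
  calc (N : ℝ) * (H * d * a / ε) ≤ N * (K * H) := mul_le_mul_of_nonneg_left h6 h4.le
    _ = K * H * N := by ring

/-- Writing `x` for the argument of the logarithm in `sampleSize`, the hypothesis on `K` says `log x
≤ K ρ`. In `K H N = (K ρ) · ρ⁻¹ · (H N)` the three logarithms are at most `K ρ`, `2 log x` and `log
x`. This removes the dependence on `log K`. -/
theorem log_le_mul_scale (hH : 1 ≤ H) (hd : 1 ≤ d) (ha : 1 ≤ a) (hN : 1 ≤ N) (hε : 0 < ε)
    (hε2 : ε < 1 / 2) (hK : sampleSize H d a N ε ≤ K) :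
    Real.log (K * H * N) ≤ 4 * (K * scale H d a ε) := by
  have hK3 : (3 : ℝ) ≤ K := by
    exact_mod_cast three_le_of_sampleSize_le hH hd ha hN hε hε2 hK
  have hρ := scale_pos hH hd ha hε
  set ρ := scale H d a ε with hρdef
  set x := (N : ℝ) * ((H : ℝ) * d * a / ε) with hx
  have h0 := two_le_sampleSize_arg hH hd ha hN hε hε2
  have hH1 : (1 : ℝ) ≤ H := by exact_mod_cast hH
  have hd1 : (1 : ℝ) ≤ d := by exact_mod_cast hd
  have ha1 : (1 : ℝ) ≤ a := by exact_mod_cast ha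
  have hN1 : (1 : ℝ) ≤ N := by exact_mod_cast hN
  have hlog : Real.log x ≤ K * ρ := by
    have := hK
    rw [sampleSize_eq, inv_mul_le_iff₀ hρ] at this
    linarith
  have hda : (1 : ℝ) ≤ d * a := by nlinarith
  have hHN : (1 : ℝ) ≤ H * N := by nlinarith
  have h1 : Real.log (H * N) ≤ Real.log x := by
    refine Real.log_le_log (by positivity) ?_
    have : (H * N : ℝ) ≤ H * N * (d * a) := le_mul_of_one_le_right (by positivity) hda
    nlinarith
  have h2 : Real.log ρ⁻¹ ≤ 2 * Real.log x := by
    rw [← Real.log_rpow (by positivity), Real.rpow_two]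
    refine Real.log_le_log (inv_pos.2 hρ) ?_
    rw [hρdef, inv_scale, hx, mul_pow, div_pow, ← mul_div_assoc]
    refine div_le_div_of_nonneg_right ?_ (by positivity)
    have h3 : (H : ℝ) ^ 2 * d * a ≤ ((H : ℝ) * d * a) ^ 2 := by
      have : (H : ℝ) ^ 2 * (d * a) ≤ (H : ℝ) ^ 2 * (d * a) * (d * a) :=
        le_mul_of_one_le_right (by positivity) hda
      nlinarith
    have h4 : ((H : ℝ) * d * a) ^ 2 ≤ (N : ℝ) ^ 2 * ((H : ℝ) * d * a) ^ 2 :=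
      le_mul_of_one_le_left (by positivity) (one_le_pow₀ hN1)
    linarith
  have h3 : Real.log (K * ρ) ≤ K * ρ := (Real.log_le_sub_one_of_pos (by positivity)).trans
    (by linarith)
  have h4 : Real.log (K * H * N) = Real.log (K * ρ) + Real.log ρ⁻¹ + Real.log (H * N) := by
    rw [← Real.log_mul (by positivity) (by positivity), ← Real.log_mul (by positivity)
      (by positivity)]
    congr 1
    field_simp
  rw [h4]
  linarith

theorem failure_le {x : ℝ} (hx : 3 ≤ x) : 2 * x * Real.exp (-(10 * Real.log x)) ≤ 0.005 := by
  have hx0 : 0 < x := by linarith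
  have h1 : Real.exp (-(10 * Real.log x)) = (x ^ 10)⁻¹ := by
    rw [Real.exp_neg, show (10 : ℝ) * Real.log x = Real.log (x ^ 10) by
      rw [Real.log_pow]; norm_num, Real.exp_log (by positivity)]
  have h2 : (3 : ℝ) ^ 9 ≤ x ^ 9 := pow_le_pow_left₀ (by norm_num) hx 9
  rw [h1, ← div_eq_mul_inv, div_le_iff₀ (by positivity)]
  have h3 : x ^ 10 = x * x ^ 9 := by ring
  rw [h3]
  nlinarith

theorem total_error_le {θ β c : ℝ} (hH : 1 ≤ H) (hd : 1 ≤ d) (ha : 1 ≤ a) (hN : 1 ≤ N)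
    (hε : 0 < ε) (hε2 : ε < 1 / 2) (hK : sampleSize H d a N ε ≤ K) (hc : 0 ≤ c)
    (hθ : θ = 10 * Real.log (K * H * N))
    (hβ : β ≤ c * (Real.log (K * H * N) + K * scale H d a ε)) :
    H * (2 * (ε / H) * K + 2 * d + 1 + 6 * Real.sqrt
      (d * (a * (32 * θ + 4 * β + 72 * (K * scale H d a ε))) * K)) ≤
      (5 + 6 * (5 * (320 + 4 * c))) * (K * ε) := by
  have hρ := scale_pos hH hd ha hε
  have h1 := log_le_mul_scale hH hd ha hN hε hε2 hK
  have h2 := steps_mul_dim_le hH hd ha hN hε hε2 hK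
  have hH1 : (1 : ℝ) ≤ H := by exact_mod_cast hH
  have hd1 : (1 : ℝ) ≤ d := by exact_mod_cast hd
  have ha1 : (1 : ℝ) ≤ a := by exact_mod_cast ha
  have hK0 : (0 : ℝ) ≤ K := Nat.cast_nonneg _
  have hH0 : (0 : ℝ) < H := by linarith
  set L := Real.log (K * H * N)
  set s := 5 * (320 + 4 * c) with hs
  have hs1 : 1 ≤ s := by linarith
  have hKρ : 0 ≤ K * scale H d a ε := by positivity
  -- Both `L` and `L + K ρ` are at most `5 K ρ`, which gives `1280 + 20 c + 72 ≤ s`.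
  have h3 : 32 * θ + 4 * β + 72 * (K * scale H d a ε) ≤ s * (K * scale H d a ε) := by
    rw [hθ, hs]
    nlinarith [mul_le_mul_of_nonneg_left h1 hc]
  have h4 : d * (a * (32 * θ + 4 * β + 72 * (K * scale H d a ε))) * K ≤ (s * (K * ε / H)) ^ 2 := by
    calc d * (a * (32 * θ + 4 * β + 72 * (K * scale H d a ε))) * K
        ≤ d * (a * (s * (K * scale H d a ε))) * K := by gcongr
      -- The scale is chosen exactly so that `d |A| ρ = (ε / H)²`.
      _ = s * (K * ε / H) ^ 2 := by rw [scale]; field_simp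
      _ ≤ s * s * (K * ε / H) ^ 2 :=
        mul_le_mul_of_nonneg_right (le_mul_of_one_le_right (by linarith) hs1) (sq_nonneg _)
      _ = (s * (K * ε / H)) ^ 2 := by ring
  have h5 := Real.sqrt_le_sqrt h4
  rw [Real.sqrt_sq (by positivity)] at h5
  calc H * (2 * (ε / H) * K + 2 * d + 1 + 6 * Real.sqrt
      (d * (a * (32 * θ + 4 * β + 72 * (K * scale H d a ε))) * K))
      ≤ H * (2 * (ε / H) * K + 2 * d + d + 6 * (s * (K * ε / H))) := by gcongr
    _ = 2 * (K * ε) + 3 * (H * d) + 6 * s * (K * ε) := by field_simp; ring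
    _ ≤ _ := by linarith

end Rates

/-! ### A finite optimal cover -/

section Cover

variable {S A : Type*}

theorem exists_finset_of_coveringNumber {V : Set (ℕ → S → A → ℝ)} {ρ : ℝ} {N : ℕ}
    (h : (N : ℕ∞) = coveringNumber V ρ) :
    ∃ W : Finset (ℕ → S → A → ℝ), (W : Set (ℕ → S → A → ℝ)) ⊆ V ∧
      (∀ f ∈ V, ∃ w ∈ W, ∀ h s a, |f h s a - w h s a| ≤ ρ) ∧ W.card = N := by
  have h1 : coveringNumber V ρ = ⨅ V₀ : {V₀ : Set (ℕ → S → A → ℝ) // V₀ ⊆ V ∧ ∀ f ∈ V, ∃ g ∈ V₀,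
      ∀ h s a, |f h s a - g h s a| ≤ ρ}, V₀.1.encard := iInf_subtype'
  have hne : Nonempty {V₀ : Set (ℕ → S → A → ℝ) // V₀ ⊆ V ∧ ∀ f ∈ V, ∃ g ∈ V₀,
      ∀ h s a, |f h s a - g h s a| ≤ ρ} := by
    by_contra hc
    rw [not_nonempty_iff] at hc
    rw [h1, iInf_of_empty] at h
    exact ENat.natCast_ne_top N h
  obtain ⟨V₀, hV₀⟩ := ciInf_mem fun V₀ : {V₀ : Set (ℕ → S → A → ℝ) // V₀ ⊆ V ∧ ∀ f ∈ V, ∃ g ∈ V₀,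
    ∀ h s a, |f h s a - g h s a| ≤ ρ} => V₀.1.encard
  simp only at hV₀
  rw [← h1, ← h] at hV₀
  have hfin : V₀.1.Finite := Set.finite_of_encard_eq_coe hV₀
  refine ⟨hfin.toFinset, by simpa using V₀.2.1, by simpa using V₀.2.2, ?_⟩
  rw [hfin.encard_eq_coe_toFinset_card] at hV₀
  exact_mod_cast hV₀

end Cover

end

end VGolf

theorem mainTheorem7 :
    ∀ B : ℝ, 1 ≤ B → ∃ c C₁ C₂ : ℝ, 0 < c ∧ 0 < C₁ ∧ 0 < C₂ ∧
      ∀ (S : Type*) (A : Type*) [MeasurableSpace S] [MeasurableSpace A]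
        [MeasurableSingletonClass A] [Fintype A] [Nonempty A]
        (M : VGolf.MDP S A) (F G : ℕ → Set (S → A → ℝ))
        (σ : ℕ → (S → A → ℝ) → S → A),
        M.IsValueClass F → M.IsValueClass G → M.IsGreedy F σ →
        M.Realizable F → M.GeneralizedComplete F G →
        ∀ (ε : ℝ), 0 < ε →
        ∀ (d N K : ℕ),
          (d : ℕ∞) = max 1 (M.minDimVBE F σ (ε / M.H)) →
          (N : ℕ∞) = VGolf.coveringNumber (M.tuples F ∪ M.tuples G)
            (VGolf.scale M.H d (Fintype.card A) ε) →
          1 ≤ K →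
          C₁ * VGolf.sampleSize M.H d (Fintype.card A) N ε ≤ K →
        ∀ β : ℝ,
          (β = c * Real.log (K * M.H * N) ∧
              (K : ℝ) ≤ B * C₁ * VGolf.sampleSize M.H d (Fintype.card A) N ε) ∨
            β = c * (Real.log (K * M.H * N) + K * VGolf.scale M.H d (Fintype.card A) ε) →
        ∀ sel : (k : ℕ) → (Fin k → M.Epoch) → ℕ → S → A → ℝ,
          M.IsVGolf F G σ K β sel →
          ENNReal.ofReal 0.99 ≤ M.outputProb σ sel K (M.IsOptimalUpTo (C₂ * ε)) := by
  intro B hB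
  -- The `80` in `c` is `8 * 10` from `8 θ` with `θ = 10 log (K H N)`, and the factor `1 + B` leaves
  -- room for the discretization error. The `200` in `C₂` is `1 / 0.005`, the price of Markov's
  -- inequality.
  refine ⟨80 * (1 + B), 1, 200 * (5 + 6 * (5 * (320 + 4 * (80 * (1 + B))))), by positivity,
    one_pos, by positivity, ?_⟩
  intro S A _ _ _ _ _ M F G σ hF hG hσ hR hC ε hε d N K hd hN hK1 hK β hβ sel hsel
  have ha : M.Admissible F G σ := ⟨hF, hG, hσ, hR, hC⟩
  rw [one_mul] at hK
  rw [mul_one] at hβ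
  set c := 80 * (1 + B) with hc
  set C₂ := 200 * (5 + 6 * (5 * (320 + 4 * c))) with hC₂
  have hc0 : 0 ≤ c := by positivity
  -- For `ε ≥ 1 / 2` the target accuracy exceeds `1`, so every policy qualifies. Otherwise the
  -- argument of the logarithm in `sampleSize` is at least `2`, which all the rate estimates need.
  rcases le_or_gt (1 / 2) ε with hε2 | hε2
  · have hprob : IsProbabilityMeasure (M.dataLaw σ sel K) := by
      rw [VGolf.MDP.dataLaw_eq]; exact (hsel.isSampling ha).isProbabilityMeasure K le_rfl
    have : Nonempty (Fin K) := ⟨⟨0, hK1⟩⟩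
    have hall : {x : (Fin K → M.Epoch) × Fin K |
        M.IsOptimalUpTo (C₂ * ε) (M.policyAt σ sel x.1 x.2)} = Set.univ :=
      Set.eq_univ_of_forall fun x => ha.isOptimalUpTo_of_one_le (by nlinarith) _
    rw [VGolf.MDP.outputProb, hall, measure_univ, ENNReal.ofReal_le_one]
    norm_num
  have hH : 1 ≤ M.H := M.H_pos
  have hA : 1 ≤ Fintype.card A := Fintype.card_pos
  have hd1 : 1 ≤ d := by
    have : (1 : ℕ∞) ≤ d := hd ▸ le_max_left _ _
    exact_mod_cast this
  -- The family attaining the minimum of the two dimensions determines which test laws are used.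
  obtain ⟨b, hb⟩ : ∃ b, M.dimVBE F σ (M.testFamily b F σ) (ε / M.H) ≤ d := by
    have h1 : M.minDimVBE F σ (ε / M.H) ≤ d := hd ▸ le_max_right _ _
    rcases min_le_iff.1 h1 with h | h
    · exact ⟨true, h⟩
    · exact ⟨false, h⟩
  obtain ⟨W, hW, hcov, hcard⟩ := VGolf.exists_finset_of_coveringNumber hN
  have hN1 : 1 ≤ N := by
    obtain ⟨w, hw, -⟩ := hcov _ (Or.inl ha.qs_mem)
    rw [← hcard]
    exact Finset.card_pos.2 ⟨w, hw⟩
  have hρ := VGolf.scale_pos hH hd1 hA hε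
  have hK3 := VGolf.three_le_of_sampleSize_le hH hd1 hA hN1 hε hε2 hK
  have hx : (3 : ℝ) ≤ K * M.H * N := by
    have : 3 * 1 * 1 ≤ K * M.H * N := Nat.mul_le_mul (Nat.mul_le_mul hK3 hH) hN1
    exact_mod_cast this
  have hL : 0 ≤ Real.log (K * M.H * N) := Real.log_nonneg (by linarith)
  have hKρ : 0 ≤ K * VGolf.scale M.H d (Fintype.card A) ε := by positivity
  have hβ' : 80 * Real.log (K * M.H * N) + 16 * (K * VGolf.scale M.H d (Fintype.card A) ε) ≤ β ∧
      β ≤ c * (Real.log (K * M.H * N) + K * VGolf.scale M.H d (Fintype.card A) ε) := by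
    rcases hβ with ⟨rfl, hKB⟩ | rfl
    -- In the first regime the upper bound on `K` gives `K ρ ≤ B log (K H N)`, so the discretization
    -- error is absorbed by the logarithmic part of `β`.
    · refine ⟨?_, mul_le_mul_of_nonneg_left (by linarith) hc0⟩
      have h1 := VGolf.log_arg_le hH hd1 hA hN1 hε hε2 hK
      rw [VGolf.sampleSize_eq, ← mul_assoc, mul_comm B, mul_assoc, ← div_eq_inv_mul,
        le_div_iff₀ hρ] at hKB
      have h2 := mul_le_mul_of_nonneg_left h1 (show 0 ≤ B by linarith)
      have h3 : 0 ≤ B * Real.log (K * M.H * N) := by positivity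
      rw [hc]
      linarith
    · exact ⟨by rw [hc]; nlinarith, le_rfl⟩
  have hmain := hsel.outputProb_ge ha b (ε := ε / M.H) (θ := 10 * Real.log (K * M.H * N))
    (ρ := VGolf.scale M.H d (Fintype.card A) ε) (η := C₂ * ε) (δ := 0.005)
    (div_pos hε (by exact_mod_cast hH)) hb hW hcov hρ.le (by linarith)
    (by linarith [hβ'.1]) hK1 (by positivity) (by norm_num)
    (by rw [hcard]; exact VGolf.failure_le hx)
    ((VGolf.total_error_le hH hd1 hA hN1 hε hε2 hK hc0 rfl hβ'.2).trans
      (le_of_eq (by rw [hC₂]; ring)))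
  convert hmain using 2
  norm_num
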